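/- **Setting.** Let $\mathbb{P}^1$ be the projective line over $\mathbb{F}_1$: the monoid scheme obtained by gluing $U_0=\operatorname{Spec}\langle t\rangle$ and $U_\infty=\operatorname{Spec}\langle t^{-1}\rangle$ along $\operatorname{Spec}\langle t,t^{-1}\rangle$, where $\langle t\rangle=\{0,1,t,t^2,\dots\}$, $\langle t^{-1}\rangle=\{0,1,t^{-1},t^{-2},\dots\}$ and $\langle t,t^{-1}\rangle=\{0\}\cup\{t^k:k\in\mathbb{Z}\}$ are commutative monoids with zero. Its points are the closed points $0,\infty$ and the generic point $\eta$. A module over a commutative monoid with zero $A$ is a pointed set $(M,*)$ with an action of $A$ such that $0\cdot m=*$ for all $m$; it is normal if, for each $a\in A$, the map $m\mapsto a\cdot m$ is injective on the set of $m$ with $a\cdot m\neq *$. A coherent sheaf on $\mathbb{P}^1$ is a sheaf of $\mathcal{O}_{\mathbb{P}^1}$-modules which near every point is the sheaf associated with a finitely generated module over the sections of $\mathcal{O}_{\mathbb{P}^1}$ on an affine open neighbourhood; it is normal if its modules of sections over affine open sets are normal. The direct sum is the wedge sum of pointed sets on affine open sets, and a nonzero normal coherent sheaf is indecomposable if it is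 not the direct sum of two nonzero coherent sheaves. Consider the following normal coherent sheaves on $\mathbb{P}^1$: - for $n\in\mathbb{Z}$, the line bundle $\mathcal{O}(n)$, glued from $\langle t\rangle$ on $U_0$ and $\langle t^{-1}\rangle$ on $U_\infty$ by the automorphism $t^k\mapsto t^{k-n}$ of $\langle t,t^{-1}\rangle$; - for an integer $n\ge 1$, the torsion sheaf $\mathcal{T}_{0,n}$, glued from $\langle t\rangle/\{0,t^n,t^{n+1},\dots\}$ on $U_0$ and the zero module on $U_\infty$, and the torsion sheaf $\mathcal{T}_{\infty,n}$, glued from the zero module on $U_0$ and $\langle t^{-1}\rangle/\{0,t^{-n},t^{-n-1},\dots\}$ on $U_\infty$; - for an integer $n\ge 1$, the cyclic sheaf $\mathcal{C}_n$, glued by the identity from the modules $\{*\}\cup\{z_i : i\in\mathbb{Z}/n\}$, with $t^k\cdot z_i=z_{i+k}$, on $U_0$ and on $U_\infty$. The Hall algebra $\mathbf{H}$ consists of the finitely supported functions, with values in $\mathbb{C}$, on the set of isomorphism classes of normal coherent sheaves on $\mathbb{P}^1$, with the product $$(f\star g)(\mathcal{F})=\sum_{\mathcal{F}'\subset\mathcal{F}}f(\mathcal{F}/\mathcal{F}')\,g(\mathcal{F}'),$$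 where the sum is over all coherent subsheaves $\mathcal{F}'$ of $\mathcal{F}$. Write $\overline{\mathcal{F}}\in\mathbf{H}$ for the delta function of the isomorphism class of $\mathcal{F}$, and $[f,g]=f\star g-g\star f$. **Statement.** In each of the following commutators both products are well defined (the sums have only finitely many nonzero terms, and the products have finite support), and in $\mathbf{H}$: 1. $[\overline{\mathcal{O}(n)},\overline{\mathcal{O}(m)}]=0$ for all $n,m\in\mathbb{Z}$; 2. $[\overline{\mathcal{T}_{x,n}},\overline{\mathcal{O}(m)}]=\overline{\mathcal{O}(m+n)}$ for all $x\in\{0,\infty\}$, $n\ge 1$ and $m\in\mathbb{Z}$; 3. $[\overline{\mathcal{T}_{x,n}},\overline{\mathcal{T}_{x',m}}]=0$ for all $x,x'\in\{0,\infty\}$ and $n,m\ge 1$; 4. $[\overline{\mathcal{C}_n},\overline{\mathcal{F}}]=0$ for all $n\ge 1$ and every indecomposable normal coherent sheaf $\mathcal{F}$. -/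

import Mathlib

open TopologicalSpace

namespace PLine

/-! ### Modules over commutative monoids with zero

An `A`-module over a commutative monoid with zero `A` is a pointed set `M` with an action of `A`
such that `0 • m` is the base point: this is `MulActionWithZero A M`. -/

section Modules

variable (A : Type) [CommMonoidWithZero A] (M : Type) [Zero M] [MulActionWithZero A M]

/-- `M` is finitely generated: there are finitely many generators such that every element is a
multiple of one of them. -/
def FinGen : Prop := ∃ s : Finset M, ∀ m : M, ∃ a : A, ∃ g ∈ s, m = a • g

/-- `M` is normal: multiplication by any `a` is injective away from the preimage of the base
point. -/
def NormalModule : Prop := ∀ (a : A) (m m' : M), a • m ≠ 0 → a • m = a • m' → m = m'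

end Modules

/-- The map `φ : M → N` from an `A`-module to a `B`-module, linear over `σ : A → B`, exhibits `N`
as the localization `S⁻¹M`: the elements of `S` act bijectively on `N`, every element of `N` is a
fraction `φ m / s`, and `φ m = φ m'` exactly when `s • m = s • m'` for some `s ∈ S`. -/
structure IsLocalizationMap {A B M N : Type} [CommMonoidWithZero A] [CommMonoidWithZero B]
    [Zero M] [MulActionWithZero A M] [Zero N] [MulActionWithZero B N]
    (S : Set A) (σ : A → B) (φ : M → N) : Prop where
  bij : ∀ s ∈ S, Function.Bijective fun n : N => σ s • n
  surj : ∀ n : N, ∃ m : M, ∃ s ∈ S, σ s • n = φ m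
  eq_iff : ∀ m m' : M, φ m = φ m' ↔ ∃ s ∈ S, s • m = s • m'

section Quotients

variable {A : Type} [CommMonoidWithZero A] {M : Type} [Zero M] [MulActionWithZero A M]

/-- The relation collapsing the submodule `N` of `M` to a point. -/
def collapse (N : SubMulAction A M) : Setoid M where
  r m m' := m = m' ∨ (m ∈ N ∧ m' ∈ N)
  iseqv :=
    { refl := fun _ => Or.inl rfl
      symm := by
        rintro x y (h | h)
        · exact Or.inl h.symm
        · exact Or.inr ⟨h.2, h.1⟩
      trans := by
        rintro x y z (rfl | h) (rfl | h')
        · exact Or.inl rfl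
        · exact Or.inr h'
        · exact Or.inr h
        · exact Or.inr ⟨h.1, h'.2⟩ }

/-- The quotient module `M / N`: the elements of `N` are identified with the base point, and no
other identifications are made. -/
def QuotMod (N : SubMulAction A M) : Type := Quotient (collapse N)

/-- The class of `m` in `M / N`. -/
def QuotMod.mk (N : SubMulAction A M) (m : M) : QuotMod N := Quotient.mk (collapse N) m

theorem QuotMod.mk_eq {N : SubMulAction A M} {m m' : M} :
    QuotMod.mk N m = QuotMod.mk N m' ↔ m = m' ∨ (m ∈ N ∧ m' ∈ N) :=
  Quotient.eq (r := collapse N)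

theorem QuotMod.mk_surj {N : SubMulAction A M} (q : QuotMod N) : ∃ m, QuotMod.mk N m = q :=
  Quotient.exists_rep q

instance (N : SubMulAction A M) : Zero (QuotMod N) := ⟨QuotMod.mk N 0⟩

theorem QuotMod.zero_def (N : SubMulAction A M) : (0 : QuotMod N) = QuotMod.mk N 0 := rfl

/-- The map induced on quotients by a map that sends the submodule `N` into the submodule `N'`. -/
def QuotMod.map {B M' : Type} [CommMonoidWithZero B] [Zero M'] [MulActionWithZero B M']
    (N : SubMulAction A M) (N' : SubMulAction B M') (φ : M → M')
    (h : ∀ m ∈ N, φ m ∈ N') : QuotMod N → QuotMod N' :=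
  Quotient.lift (fun m => QuotMod.mk N' (φ m)) (by
    rintro m m' (rfl | hm)
    · rfl
    · exact QuotMod.mk_eq.2 (Or.inr ⟨h _ hm.1, h _ hm.2⟩))

instance (N : SubMulAction A M) : SMul A (QuotMod N) :=
  ⟨fun a => QuotMod.map N N (fun m => a • m) (fun _ hm => N.smul_mem a hm)⟩

theorem QuotMod.smul_mk (N : SubMulAction A M) (a : A) (m : M) :
    a • QuotMod.mk N m = QuotMod.mk N (a • m) := rfl

instance (N : SubMulAction A M) : MulActionWithZero A (QuotMod N) where
  one_smul q := by
    obtain ⟨m, rfl⟩ := QuotMod.mk_surj q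
    rw [QuotMod.smul_mk, one_smul]
  mul_smul a b q := by
    obtain ⟨m, rfl⟩ := QuotMod.mk_surj q
    simp only [QuotMod.smul_mk, mul_smul]
  smul_zero a := by
    rw [QuotMod.zero_def, QuotMod.smul_mk, smul_zero]
  zero_smul q := by
    obtain ⟨m, rfl⟩ := QuotMod.mk_surj q
    rw [QuotMod.smul_mk, zero_smul, QuotMod.zero_def]

end Quotients

/-! ### The monoid scheme `ℙ¹` -/

/-- The three points of `ℙ¹`: the closed points `0` and `∞`, and the generic point `η`. -/
inductive P1 : Type
  | origin : P1
  | infty : P1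
  | eta : P1

/-- A set of points is open when it is empty or contains the generic point. So the open sets are
`∅`, `{η}`, `U₀ = {0, η}`, `U_∞ = {∞, η}` and `ℙ¹`. -/
instance : TopologicalSpace P1 where
  IsOpen U := U.Nonempty → P1.eta ∈ U
  isOpen_univ := fun _ => trivial
  isOpen_inter := fun _ _ hs ht h => ⟨hs (h.mono Set.inter_subset_left),
    ht (h.mono Set.inter_subset_right)⟩
  isOpen_sUnion := fun s hs h => by
    obtain ⟨x, U, hU, hx⟩ := h
    exact ⟨U, hU, hs U hU ⟨x, hx⟩⟩

theorem eta_mem {U : Opens P1} {x : P1} (hx : x ∈ U) : P1.eta ∈ U := U.isOpen ⟨x, hx⟩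

/-- The monoid `⟨t, t⁻¹⟩ = {0} ∪ {tᵏ : k ∈ ℤ}`. -/
abbrev Laurent : Type := WithZero (Multiplicative ℤ)

/-- The element `tᵏ` of `⟨t, t⁻¹⟩`. -/
abbrev tpow (k : ℤ) : Laurent := WithZero.exp k

/-- The stalks of the structure sheaf, as submonoids of `⟨t, t⁻¹⟩`: the stalk is `⟨t⟩` at `0`,
`⟨t⁻¹⟩` at `∞`, and `⟨t, t⁻¹⟩` at `η`. -/
def stalk : P1 → Submonoid Laurent
  | .origin =>
    { carrier := {a | a = 0 ∨ ∃ k : ℕ, a = tpow k}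
      one_mem' := Or.inr ⟨0, by simp [tpow]⟩
      mul_mem' := by
        rintro a b (rfl | ⟨k, rfl⟩) (rfl | ⟨l, rfl⟩)
        · simp
        · simp
        · simp
        · exact Or.inr ⟨k + l, by simp [tpow, WithZero.exp_add]⟩ }
  | .infty =>
    { carrier := {a | a = 0 ∨ ∃ k : ℕ, a = tpow (-k)}
      one_mem' := Or.inr ⟨0, by simp [tpow]⟩
      mul_mem' := by
        rintro a b (rfl | ⟨k, rfl⟩) (rfl | ⟨l, rfl⟩)
        · simp
        · simp
        · simp
        · exact Or.inr ⟨k + l, by rw [← WithZero.exp_add]; congr 1; push_cast; ring⟩ }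
  | .eta => ⊤

theorem zero_mem_stalk (x : P1) : (0 : Laurent) ∈ stalk x := by
  cases x
  · exact Or.inl rfl
  · exact Or.inl rfl
  · trivial

theorem stalk_le_eta (x : P1) : stalk x ≤ stalk P1.eta := fun _ _ => trivial

instance (x : P1) : CommMonoidWithZero (stalk x) :=
  { (inferInstance : CommMonoid (stalk x)) with
    zero := ⟨0, zero_mem_stalk x⟩
    zero_mul := fun a => Subtype.ext (zero_mul (a : Laurent))
    mul_zero := fun a => Subtype.ext (mul_zero (a : Laurent)) }

/-- The sections over `U` of the structure sheaf: families of germs which have the same image in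
the generic stalk. So `𝒪(U₀) = ⟨t⟩`, `𝒪(U_∞) = ⟨t⁻¹⟩`, `𝒪({η}) = ⟨t, t⁻¹⟩`, `𝒪(ℙ¹) = {0, 1}`, and
`𝒪(∅)` is a point. -/
def Reg (U : Opens P1) : Type :=
  {a : (x : U) → stalk x // ∀ x y : U, (a x : Laurent) = a y}

namespace Reg

variable {U V : Opens P1}

/-- The germ of a section at a point. -/
def germ (a : Reg U) (x : U) : stalk x := a.1 x

@[ext] theorem ext {a b : Reg U} (h : ∀ x, a.germ x = b.germ x) : a = b :=
  Subtype.ext (funext h)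

instance : One (Reg U) := ⟨⟨fun _ => 1, fun _ _ => rfl⟩⟩
instance : Zero (Reg U) := ⟨⟨fun _ => 0, fun _ _ => rfl⟩⟩
instance : Mul (Reg U) := ⟨fun a b => ⟨fun x => a.1 x * b.1 x, fun x y => by
  have h₁ := a.2 x y
  have h₂ := b.2 x y
  simp only [Submonoid.coe_mul, h₁, h₂]⟩⟩

instance : CommMonoidWithZero (Reg U) where
  mul_assoc a b c := ext fun x => mul_assoc (a.1 x) (b.1 x) (c.1 x)
  mul_comm a b := ext fun x => mul_comm (a.1 x) (b.1 x)
  one_mul a := ext fun x => one_mul (a.1 x)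
  mul_one a := ext fun x => mul_one (a.1 x)
  zero_mul a := ext fun x => zero_mul (a.1 x)
  mul_zero a := ext fun x => mul_zero (a.1 x)

/-- Restriction of sections of the structure sheaf. -/
def res (h : U ≤ V) (a : Reg V) : Reg U :=
  ⟨fun x => a.1 ⟨x, h x.2⟩, fun x y => a.2 ⟨x, h x.2⟩ ⟨y, h y.2⟩⟩

/-- The basic open set `D(f)`: the points of `U` at which the germ of `f` is invertible. -/
def basicOpen (f : Reg U) : Opens P1 where
  carrier := {x | ∃ h : x ∈ U, IsUnit (f.germ ⟨x, h⟩)}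
  is_open' := by
    rintro ⟨x, hx, hu⟩
    refine ⟨eta_mem hx, ?_⟩
    obtain ⟨b, hb⟩ := hu.exists_right_inv
    refine IsUnit.of_mul_eq_one (⟨b, stalk_le_eta x b.2⟩ : stalk P1.eta) ?_
    apply Subtype.ext
    have h₁ : (f.germ ⟨x, hx⟩ : Laurent) * b = 1 := congrArg Subtype.val hb
    have h₂ : (f.germ ⟨P1.eta, eta_mem hx⟩ : Laurent) = f.germ ⟨x, hx⟩ :=
      f.2 ⟨P1.eta, eta_mem hx⟩ ⟨x, hx⟩
    exact (congrArg (· * (b : Laurent)) h₂).trans h₁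

theorem basicOpen_le (f : Reg U) : f.basicOpen ≤ U := fun _ hx => hx.1

end Reg

/-- The affine open sets of `ℙ¹` are `∅`, `{η} = Spec ⟨t, t⁻¹⟩`, `U₀ = Spec ⟨t⟩` and
`U_∞ = Spec ⟨t⁻¹⟩`, that is, all open sets except `ℙ¹` itself. -/
def IsAffine (U : Opens P1) : Prop := U ≠ ⊤

/-- The smallest open neighbourhood `{x, η}` of a point: `U₀` for `x = 0`, `U_∞` for `x = ∞`, and
`{η}` for `x = η`. -/
def nbhd (x : P1) : Opens P1 := ⟨{y | y = x ∨ y = P1.eta}, fun _ => Or.inr rfl⟩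

/-! ### Sheaves of modules -/

/-- A sheaf of `𝒪`-modules on `ℙ¹`. -/
structure ModSheaf : Type 1 where
  sec : Opens P1 → Type
  [zero : ∀ U, Zero (sec U)]
  [act : ∀ U, MulActionWithZero (Reg U) (sec U)]
  res : ∀ {U V : Opens P1}, U ≤ V → sec V → sec U
  res_refl : ∀ (U : Opens P1) (s : sec U), res (le_refl U) s = s
  res_res : ∀ {U V W : Opens P1} (h : U ≤ V) (h' : V ≤ W) (s : sec W),
    res h (res h' s) = res (h.trans h') s
  res_smul : ∀ {U V : Opens P1} (h : U ≤ V) (a : Reg V) (s : sec V),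
    res h (a • s) = Reg.res h a • res h s
  glue : ∀ {ι : Type} (W : ι → Opens P1) (s : ∀ i, sec (W i)),
    (∀ i j, res (inf_le_left : W i ⊓ W j ≤ W i) (s i) =
      res (inf_le_right : W i ⊓ W j ≤ W j) (s j)) →
    ∃! t : sec (⨆ i, W i), ∀ i, res (le_iSup W i) t = s i

attribute [instance] ModSheaf.zero ModSheaf.act

namespace ModSheaf

/-- `F` is coherent: every point has an affine open neighbourhood `U` such that `F` restricted to
`U` is the sheaf associated with a finitely generated `𝒪(U)`-module `M`, i.e. `M = F(U)` is
finitely generated and `F(D(f))` is the localization of `M` at the powers of `f`, for every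
`f ∈ 𝒪(U)`. -/
def IsCoherent (F : ModSheaf) : Prop :=
  ∀ x : P1, ∃ U : Opens P1, IsAffine U ∧ x ∈ U ∧ FinGen (Reg U) (F.sec U) ∧
    ∀ f : Reg U, IsLocalizationMap (Submonoid.powers f : Set (Reg U)) (Reg.res f.basicOpen_le)
      (F.res f.basicOpen_le)

/-- `F` is normal: the module of sections over every affine open set is normal. -/
def IsNormal (F : ModSheaf) : Prop :=
  ∀ U : Opens P1, IsAffine U → NormalModule (Reg U) (F.sec U)

/-- An isomorphism of sheaves of `𝒪`-modules. -/
structure Iso (F G : ModSheaf) where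
  toEquiv : ∀ U, F.sec U ≃ G.sec U
  map_smul : ∀ (U : Opens P1) (a : Reg U) (s : F.sec U), toEquiv U (a • s) = a • toEquiv U s
  map_res : ∀ {U V : Opens P1} (h : U ≤ V) (s : F.sec V),
    toEquiv U (F.res h s) = G.res h (toEquiv V s)

theorem res_zero (F : ModSheaf) {U V : Opens P1} (h : U ≤ V) : F.res h (0 : F.sec V) = 0 := by
  have h₁ := F.res_smul h 0 0
  rw [zero_smul] at h₁
  rw [h₁]
  exact zero_smul (Reg U) _

end ModSheaf

/-- A subsheaf of `𝒪`-modules of `F`. -/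
structure SubModSheaf (F : ModSheaf) where
  sec : ∀ U : Opens P1, SubMulAction (Reg U) (F.sec U)
  zero_mem : ∀ U, (0 : F.sec U) ∈ sec U
  res_mem : ∀ {U V : Opens P1} (h : U ≤ V) {s : F.sec V}, s ∈ sec V → F.res h s ∈ sec U
  local_mem : ∀ {ι : Type} (W : ι → Opens P1) (s : F.sec (⨆ i, W i)),
    (∀ i, F.res (le_iSup W i) s ∈ sec (W i)) → s ∈ sec (⨆ i, W i)

instance SubModSheaf.instZero {F : ModSheaf} (G : SubModSheaf F) (U : Opens P1) :
    Zero (G.sec U) := ⟨⟨0, G.zero_mem U⟩⟩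

instance SubModSheaf.instAct {F : ModSheaf} (G : SubModSheaf F) (U : Opens P1) :
    MulActionWithZero (Reg U) (G.sec U) :=
  { (inferInstance : MulAction (Reg U) (G.sec U)) with
    smul_zero := fun a => Subtype.ext (smul_zero a)
    zero_smul := fun m => Subtype.ext (zero_smul (Reg U) (m : F.sec U)) }

/-- A subsheaf, viewed as a sheaf of `𝒪`-modules in its own right. -/
def SubModSheaf.toModSheaf {F : ModSheaf} (G : SubModSheaf F) : ModSheaf where
  sec U := G.sec U
  res h s := ⟨F.res h s, G.res_mem h s.2⟩
  res_refl U s := Subtype.ext (F.res_refl U s)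
  res_res h h' s := Subtype.ext (F.res_res h h' s)
  res_smul h a s := Subtype.ext (F.res_smul h a s)
  glue W s hs := by
    obtain ⟨t, ht, hu⟩ := F.glue W (fun i => (s i : F.sec (W i)))
      (fun i j => congrArg Subtype.val (hs i j))
    refine ⟨⟨t, G.local_mem W t fun i => by rw [ht i]; exact (s i).2⟩,
      fun i => Subtype.ext (ht i), ?_⟩
    intro t' ht'
    exact Subtype.ext (hu t' fun i => congrArg Subtype.val (ht' i))

/-- The objects of `Coh_n(ℙ¹)`: normal coherent sheaves on `ℙ¹`. -/
structure NormalCoh : Type 1 where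
  sheaf : ModSheaf
  coherent : sheaf.IsCoherent
  normal : sheaf.IsNormal

/-- A coherent subsheaf of a normal coherent sheaf. -/
structure CohSub (F : NormalCoh) where
  sub : SubModSheaf F.sheaf
  coherent : sub.toModSheaf.IsCoherent

/-- A coherent subsheaf of a normal coherent sheaf is itself a normal coherent sheaf. -/
def CohSub.toNormalCoh {F : NormalCoh} (G : CohSub F) : NormalCoh where
  sheaf := G.sub.toModSheaf
  coherent := G.coherent
  normal U hU a m m' h0 h := Subtype.ext
    (F.normal U hU a m.1 m'.1 (fun h' => h0 (Subtype.ext h')) (congrArg Subtype.val h))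

/-- `F` is the zero sheaf. -/
def NormalCoh.IsZero (F : NormalCoh) : Prop := ∀ (U : Opens P1) (s : F.sheaf.sec U), s = 0

/-- `F` is the direct sum of its coherent subsheaves `G` and `H`. Direct sums of modules are wedge
sums of pointed sets, so this means that on every affine open set every section belongs to `G` or
to `H`, and only the zero section belongs to both. -/
def IsDirectSum {F : NormalCoh} (G H : CohSub F) : Prop :=
  ∀ U : Opens P1, IsAffine U → ∀ s : F.sheaf.sec U,
    (s ∈ G.sub.sec U ∨ s ∈ H.sub.sec U) ∧ (s ∈ G.sub.sec U → s ∈ H.sub.sec U → s = 0)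

/-- `F` is indecomposable: it is nonzero and is not a direct sum of two nonzero coherent
sheaves. -/
def NormalCoh.Indecomposable (F : NormalCoh) : Prop :=
  ¬ F.IsZero ∧ ∀ G H : CohSub F, IsDirectSum G H → G.toNormalCoh.IsZero ∨ H.toNormalCoh.IsZero

/-! ### Gluing -/

/-- Gluing data for a normal coherent sheaf on `ℙ¹`: a finitely generated normal module over
`⟨t⟩`, one over `⟨t⁻¹⟩`, and a `⟨t, t⁻¹⟩`-module which is identified with the localization (at all
nonzero elements, i.e. at the powers of `t`, resp. of `t⁻¹`) of either of them. -/
structure GluingData : Type 1 where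
  M : P1 → Type
  [zero : ∀ x, Zero (M x)]
  [act : ∀ x, MulActionWithZero (stalk x) (M x)]
  ρ : ∀ x, M x → M P1.eta
  ρ_eta : ∀ m, ρ P1.eta m = m
  ρ_smul : ∀ x (a : stalk x) (m : M x), ρ x (a • m) = Submonoid.inclusion (stalk_le_eta x) a • ρ x m
  loc : ∀ x, IsLocalizationMap {a : stalk x | a ≠ 0} (Submonoid.inclusion (stalk_le_eta x)) (ρ x)
  finGen : ∀ x, FinGen (stalk x) (M x)
  normal : ∀ x, NormalModule (stalk x) (M x)

attribute [instance] GluingData.zero GluingData.act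

namespace Reg

variable {U V : Opens P1}

theorem res_one (h : U ≤ V) : res h 1 = 1 := rfl

theorem res_pow (h : U ≤ V) (a : Reg V) (n : ℕ) : res h (a ^ n) = res h a ^ n := by
  induction n with
  | zero => simp only [pow_zero]; rfl
  | succ n ih => rw [pow_succ, pow_succ, ← ih]; rfl

theorem germ_pow (a : Reg U) (n : ℕ) (x : U) : (a ^ n).germ x = a.germ x ^ n := by
  induction n with
  | zero => simp only [pow_zero]; rfl
  | succ n ih => rw [pow_succ, pow_succ, ← ih]; rfl

theorem isUnit_res_basicOpen (f : Reg U) : IsUnit (res f.basicOpen_le f) := by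
  have key : ∀ x : f.basicOpen, ((f.germ ⟨x, f.basicOpen_le x.2⟩ : Laurent)) ≠ 0 ∧
      ((f.germ ⟨x, f.basicOpen_le x.2⟩ : Laurent))⁻¹ ∈ stalk x := by
    rintro ⟨x, hx, hu⟩
    obtain ⟨b, hb⟩ := hu.exists_right_inv
    have h₁ : (f.germ ⟨x, hx⟩ : Laurent) * b = 1 := congrArg Subtype.val hb
    refine ⟨left_ne_zero_of_mul_eq_one h₁, ?_⟩
    change (f.germ ⟨x, hx⟩ : Laurent)⁻¹ ∈ stalk x
    rw [inv_eq_of_mul_eq_one_right h₁]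
    exact b.2
  refine IsUnit.of_mul_eq_one ⟨fun x => ⟨_, (key x).2⟩, fun x y => ?_⟩ ?_
  · exact congrArg (·⁻¹) (f.2 ⟨x, f.basicOpen_le x.2⟩ ⟨y, f.basicOpen_le y.2⟩)
  · exact ext fun x => Subtype.ext (mul_inv_cancel₀ (key x).1)

/-- The section over the smallest neighbourhood of `x` with a given germ at `x`. -/
def const (x : P1) : stalk x →*₀ Reg (nbhd x) where
  toFun c := ⟨fun y => ⟨c, by
    obtain ⟨y, rfl | rfl⟩ := y
    · exact c.2
    · trivial⟩, fun _ _ => rfl⟩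
  map_zero' := rfl
  map_one' := rfl
  map_mul' _ _ := rfl

end Reg

theorem self_mem_nbhd (x : P1) : x ∈ nbhd x := Or.inl rfl

theorem eta_nbhd_le (x : P1) : nbhd P1.eta ≤ nbhd x := by
  rintro y (rfl | rfl)
  · exact Or.inr rfl
  · exact Or.inr rfl

theorem nbhd_le {x : P1} {U : Opens P1} (hx : x ∈ U) : nbhd x ≤ U := by
  rintro y (rfl | rfl)
  · exact hx
  · exact eta_mem hx

theorem nbhd_affine (x : P1) : IsAffine (nbhd x) := by
  intro h
  cases x
  · have : P1.infty ∈ nbhd P1.origin := h ▸ trivial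
    rcases this with h | h <;> cases h
  · have : P1.origin ∈ nbhd P1.infty := h ▸ trivial
    rcases this with h | h <;> cases h
  · have : P1.origin ∈ nbhd P1.eta := h ▸ trivial
    rcases this with h | h <;> cases h

theorem affine_eq_nbhd {x : P1} (hx : x ≠ P1.eta) {U : Opens P1} (hU : IsAffine U) (h : x ∈ U) :
    U = nbhd x := by
  refine le_antisymm (fun y hy => ?_) (nbhd_le h)
  by_contra hy'
  apply hU
  refine le_antisymm le_top (fun z _ => ?_)
  have := eta_mem h
  cases x <;> cases y <;> cases z <;> first
    | assumption
    | exact False.elim (hx rfl)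
    | exact False.elim (hy' (Or.inl rfl))
    | exact False.elim (hy' (Or.inr rfl))

theorem affine_eq {U : Opens P1} (hU : IsAffine U) : (∀ x, x ∉ U) ∨ ∃ x, U = nbhd x := by
  by_cases h0 : P1.origin ∈ U
  · exact Or.inr ⟨_, affine_eq_nbhd (by simp) hU h0⟩
  by_cases h1 : P1.infty ∈ U
  · exact Or.inr ⟨_, affine_eq_nbhd (by simp) hU h1⟩
  by_cases h2 : P1.eta ∈ U
  · refine Or.inr ⟨P1.eta, le_antisymm (fun y hy => ?_) (nbhd_le h2)⟩
    cases y
    · exact absurd hy h0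
    · exact absurd hy h1
    · exact Or.inl rfl
  · exact Or.inl fun x hx => h2 (eta_mem hx)

/-- Any nonzero element of a stalk divides a power of any given nonzero element that is not
invertible. -/
theorem exists_pow_eq_mul {x : P1} {a s : stalk x} (ha : (a : Laurent) ≠ 0) (hu : ¬ IsUnit a)
    (hs : s ≠ 0) : ∃ (k : ℕ) (b : stalk x), a ^ k = s * b := by
  have hs' : (s : Laurent) ≠ 0 := fun h => hs (Subtype.ext h)
  cases x with
  | origin =>
    obtain ⟨a, rfl | ⟨i, rfl⟩⟩ := a
    · exact absurd rfl ha
    obtain ⟨s, rfl | ⟨j, rfl⟩⟩ := s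
    · exact absurd rfl hs'
    rcases i with _ | i
    · exact absurd (by convert isUnit_one (M := stalk P1.origin); simp [tpow]) hu
    · refine ⟨j, ⟨tpow ((i * j : ℕ) : ℤ), Or.inr ⟨_, rfl⟩⟩, Subtype.ext ?_⟩
      change tpow _ ^ j = tpow _ * tpow _
      rw [← WithZero.exp_add, ← WithZero.exp_nsmul]
      congr 1; push_cast; simp only [nsmul_eq_mul]; ring
  | infty =>
    obtain ⟨a, rfl | ⟨i, rfl⟩⟩ := a
    · exact absurd rfl ha
    obtain ⟨s, rfl | ⟨j, rfl⟩⟩ := s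
    · exact absurd rfl hs'
    rcases i with _ | i
    · exact absurd (by convert isUnit_one (M := stalk P1.infty); simp [tpow]) hu
    · refine ⟨j, ⟨tpow (-((i * j : ℕ) : ℤ)), Or.inr ⟨_, rfl⟩⟩, Subtype.ext ?_⟩
      change tpow _ ^ j = tpow _ * tpow _
      rw [← WithZero.exp_add, ← WithZero.exp_nsmul]
      congr 1; push_cast; simp only [nsmul_eq_mul]; ring
  | eta =>
    exfalso
    apply hu
    exact IsUnit.of_mul_eq_one (⟨(a : Laurent)⁻¹, trivial⟩ : stalk P1.eta)
      (Subtype.ext (mul_inv_cancel₀ ha))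

namespace GluingData

variable (D : GluingData)

/-- The sections over `U` of the glued sheaf: families of elements of the given modules that are
compatible with the identifications. -/
def Sec (U : Opens P1) : Type :=
  {s : (x : U) → D.M x // ∀ x : U, D.ρ x (s x) = s ⟨P1.eta, eta_mem x.2⟩}

variable {D}

theorem Sec.ext {U : Opens P1} {s t : D.Sec U} (h : ∀ x, s.1 x = t.1 x) : s = t :=
  Subtype.ext (funext h)

theorem ρ_zero (x : P1) : D.ρ x 0 = 0 := by
  have h := D.ρ_smul x 0 0
  rw [zero_smul] at h
  rw [h]
  exact zero_smul (stalk P1.eta) _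

instance (U : Opens P1) : Zero (D.Sec U) := ⟨⟨fun _ => 0, fun x => ρ_zero x.1⟩⟩

instance (U : Opens P1) : SMul (Reg U) (D.Sec U) :=
  ⟨fun a s => ⟨fun x => a.germ x • s.1 x, fun x => by
    rw [D.ρ_smul, s.2 x]
    congr 1
    exact Subtype.ext (a.2 x ⟨P1.eta, eta_mem x.2⟩)⟩⟩

instance (U : Opens P1) : MulActionWithZero (Reg U) (D.Sec U) where
  one_smul s := Sec.ext fun x => one_smul (stalk x) (s.1 x)
  mul_smul a b s := Sec.ext fun x => mul_smul (a.germ x) (b.germ x) (s.1 x)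
  smul_zero a := Sec.ext fun x => smul_zero (a.germ x)
  zero_smul s := Sec.ext fun x => zero_smul (stalk x) (s.1 x)

theorem Sec.smul_val {U : Opens P1} (a : Reg U) (s : D.Sec U) (x : U) :
    (a • s).1 x = a.germ x • s.1 x := rfl

theorem Sec.ext_at {U : Opens P1} {x : P1} (hx : x ∈ U) (hU : U ≤ nbhd x) {s t : D.Sec U}
    (h : s.1 ⟨x, hx⟩ = t.1 ⟨x, hx⟩) : s = t := by
  refine Sec.ext ?_
  rintro ⟨y, hy⟩
  rcases hU hy with rfl | rfl
  · exact h
  · rw [← s.2 ⟨x, hx⟩, ← t.2 ⟨x, hx⟩, h]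

theorem Sec.exists_germ {x : P1} (m : D.M x) :
    ∃ s : D.Sec (nbhd x), s.1 ⟨x, self_mem_nbhd x⟩ = m := by
  cases x with
  | origin =>
    refine ⟨⟨fun y => match y with
      | ⟨.origin, _⟩ => m
      | ⟨.eta, _⟩ => D.ρ _ m
      | ⟨.infty, h⟩ => False.elim (by rcases h with h | h <;> cases h), ?_⟩, rfl⟩
    rintro ⟨_ | _ | _, h⟩
    · rfl
    · rcases h with h | h <;> cases h
    · exact D.ρ_eta _
  | infty =>
    refine ⟨⟨fun y => match y with
      | ⟨.infty, _⟩ => m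
      | ⟨.eta, _⟩ => D.ρ _ m
      | ⟨.origin, h⟩ => False.elim (by rcases h with h | h <;> cases h), ?_⟩, rfl⟩
    rintro ⟨_ | _ | _, h⟩
    · rcases h with h | h <;> cases h
    · rfl
    · exact D.ρ_eta _
  | eta =>
    refine ⟨⟨fun y => match y with
      | ⟨.eta, _⟩ => m
      | ⟨.infty, h⟩ => False.elim (by rcases h with h | h <;> cases h)
      | ⟨.origin, h⟩ => False.elim (by rcases h with h | h <;> cases h), ?_⟩, rfl⟩
    rintro ⟨_ | _ | _, h⟩
    · rcases h with h | h <;> cases h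
    · rcases h with h | h <;> cases h
    · exact D.ρ_eta _

variable (D)

/-- The sheaf obtained by gluing. -/
def toModSheaf : ModSheaf where
  sec := D.Sec
  res h s := ⟨fun x => s.1 ⟨x, h x.2⟩, fun x => s.2 ⟨x, h x.2⟩⟩
  res_refl _ _ := rfl
  res_res _ _ _ := rfl
  res_smul _ _ _ := rfl
  glue {ι} W s hs := by
    have hmem : ∀ x : ↥(⨆ i, W i), ∃ i, (x : P1) ∈ W i := fun x => Opens.mem_iSup.1 x.2
    choose i hi using hmem
    have agree : ∀ (j k : ι) (x : P1) (hj : x ∈ W j) (hk : x ∈ W k),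
        (s j).1 ⟨x, hj⟩ = (s k).1 ⟨x, hk⟩ := fun j k x hj hk =>
      congrFun (congrArg Subtype.val (hs j k)) ⟨x, hj, hk⟩
    refine ⟨⟨fun x => (s (i x)).1 ⟨x, hi x⟩, fun x => ?_⟩, fun j => ?_, fun t ht => ?_⟩
    · rw [(s (i x)).2 ⟨x, hi x⟩]
      exact agree _ _ _ _ _
    · exact Sec.ext fun x => agree _ _ _ _ _
    · refine Sec.ext fun x => ?_
      exact congrFun (congrArg Subtype.val (ht (i x))) ⟨x, hi x⟩

theorem toModSheaf_finGen (x : P1) : FinGen (Reg (nbhd x)) (D.toModSheaf.sec (nbhd x)) := by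
  classical
  obtain ⟨S, hS⟩ := D.finGen x
  choose g hg using fun m : D.M x => Sec.exists_germ m
  refine ⟨S.image g, fun s => ?_⟩
  obtain ⟨a, m, hm, h⟩ := hS (s.1 ⟨x, self_mem_nbhd x⟩)
  refine ⟨Reg.const x a, g m, Finset.mem_image_of_mem g hm, ?_⟩
  refine Sec.ext_at (self_mem_nbhd x) le_rfl ?_
  rw [h]
  change _ = a • (g m).1 ⟨x, self_mem_nbhd x⟩
  rw [hg]

theorem toModSheaf_loc (x : P1) (f : Reg (nbhd x)) :
    IsLocalizationMap (Submonoid.powers f : Set (Reg (nbhd x))) (Reg.res f.basicOpen_le)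
      (D.toModSheaf.res f.basicOpen_le) := by
  have bij : ∀ s ∈ (Submonoid.powers f : Set (Reg (nbhd x))),
      Function.Bijective fun n : D.Sec f.basicOpen => Reg.res f.basicOpen_le s • n := by
    rintro _ ⟨k, rfl⟩
    obtain ⟨u, hu⟩ := f.isUnit_res_basicOpen.pow k
    simp only [Reg.res_pow, ← hu]
    exact MulAction.bijective u
  have back : ∀ m m' : D.Sec (nbhd x),
      (∃ s ∈ (Submonoid.powers f : Set (Reg (nbhd x))), s • m = s • m') →
      D.toModSheaf.res f.basicOpen_le m = D.toModSheaf.res f.basicOpen_le m' := by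
    rintro m m' ⟨s, hs, h⟩
    apply (bij s hs).1
    exact congrArg (D.toModSheaf.res f.basicOpen_le) h
  have hxn := self_mem_nbhd x
  by_cases hx : x ∈ f.basicOpen
  · refine ⟨bij, fun n => ?_, fun m m' => ⟨fun h => ⟨1, one_mem _, ?_⟩, back m m'⟩⟩
    · obtain ⟨m, hm⟩ := Sec.exists_germ (n.1 ⟨x, hx⟩)
      refine ⟨m, 1, one_mem _, ?_⟩
      rw [Reg.res_one]
      refine (one_smul _ _).trans (Sec.ext_at hx f.basicOpen_le ?_)
      exact hm.symm
    · rw [one_smul, one_smul]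
      exact Sec.ext_at hxn le_rfl (congrFun (congrArg Subtype.val h) ⟨x, hx⟩)
  have hxu : ¬ IsUnit (f.germ ⟨x, hxn⟩) := fun h => hx ⟨hxn, h⟩
  by_cases he : P1.eta ∈ f.basicOpen
  · have hle : f.basicOpen ≤ nbhd P1.eta := by
      intro y hy
      rcases f.basicOpen_le hy with rfl | rfl
      · exact absurd hy hx
      · exact Or.inl rfl
    have ha : (f.germ ⟨x, hxn⟩ : Laurent) ≠ 0 := by
      obtain ⟨h₁, h₂⟩ := he
      obtain ⟨b, hb⟩ := h₂.exists_right_inv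
      have h₃ : (f.germ ⟨P1.eta, h₁⟩ : Laurent) * b = 1 := congrArg Subtype.val hb
      have h₄ : (f.germ ⟨x, hxn⟩ : Laurent) = f.germ ⟨P1.eta, h₁⟩ := f.2 _ _
      rw [h₄]
      exact left_ne_zero_of_mul_eq_one h₃
    refine ⟨bij, fun n => ?_, fun m m' => ⟨fun h => ?_, back m m'⟩⟩
    · obtain ⟨m, s, hs, h⟩ := (D.loc x).surj (n.1 ⟨P1.eta, he⟩)
      obtain ⟨k, b, hb⟩ := exists_pow_eq_mul ha hxu hs
      obtain ⟨r, hr⟩ := Sec.exists_germ (b • m)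
      refine ⟨r, f ^ k, ⟨k, rfl⟩, Sec.ext_at he hle ?_⟩
      have h₁ : ((f ^ k).germ ⟨P1.eta, f.basicOpen_le he⟩ : stalk P1.eta) =
          Submonoid.inclusion (stalk_le_eta x) b * Submonoid.inclusion (stalk_le_eta x) s := by
        apply Subtype.ext
        have h₂ := (f ^ k).2 ⟨P1.eta, f.basicOpen_le he⟩ ⟨x, hxn⟩
        refine h₂.trans ?_
        have h₃ := Reg.germ_pow f k ⟨x, hxn⟩
        rw [hb] at h₃
        rw [mul_comm]
        exact congrArg Subtype.val h₃
      have h₂ : r.1 ⟨P1.eta, f.basicOpen_le he⟩ = D.ρ x (b • m) := by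
        rw [← hr, r.2 ⟨x, hxn⟩]
      change (f ^ k).germ ⟨P1.eta, f.basicOpen_le he⟩ • n.1 ⟨P1.eta, he⟩ =
        r.1 ⟨P1.eta, f.basicOpen_le he⟩
      rw [h₂, h₁, mul_smul, h, D.ρ_smul]
    · have h₁ : m.1 ⟨P1.eta, f.basicOpen_le he⟩ = m'.1 ⟨P1.eta, f.basicOpen_le he⟩ :=
        congrFun (congrArg Subtype.val h) ⟨P1.eta, he⟩
      rw [← m.2 ⟨x, hxn⟩, ← m'.2 ⟨x, hxn⟩] at h₁
      obtain ⟨s, hs, h₂⟩ := ((D.loc x).eq_iff _ _).1 h₁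
      obtain ⟨k, b, hb⟩ := exists_pow_eq_mul ha hxu hs
      refine ⟨f ^ k, ⟨k, rfl⟩, Sec.ext_at hxn le_rfl ?_⟩
      change (f ^ k).germ ⟨x, hxn⟩ • m.1 ⟨x, hxn⟩ = (f ^ k).germ ⟨x, hxn⟩ • m'.1 ⟨x, hxn⟩
      rw [Reg.germ_pow, hb, mul_comm, mul_smul, mul_smul, h₂]
  · have hemp : ∀ y, y ∉ f.basicOpen := fun y hy => he (eta_mem hy)
    have hsub : ∀ n n' : D.Sec f.basicOpen, n = n' := fun n n' =>
      Sec.ext fun y => absurd y.2 (hemp y)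
    have hf : f = 0 := by
      have h₀ : (f.germ ⟨P1.eta, eta_mem hxn⟩ : Laurent) = 0 := by
        by_contra h
        exact he ⟨eta_mem hxn, IsUnit.of_mul_eq_one
          (⟨(f.germ ⟨P1.eta, eta_mem hxn⟩ : Laurent)⁻¹, trivial⟩ : stalk P1.eta)
          (Subtype.ext (mul_inv_cancel₀ h))⟩
      exact Reg.ext fun y => Subtype.ext ((f.2 y ⟨P1.eta, eta_mem hxn⟩).trans h₀)
    refine ⟨bij, fun n => ⟨0, 1, one_mem _, hsub _ _⟩, fun m m' => ⟨fun _ => ?_, back m m'⟩⟩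
    refine ⟨f, Submonoid.mem_powers f, ?_⟩
    rw [hf, zero_smul, zero_smul]

/-- The normal coherent sheaf obtained by gluing. -/
def toNormalCoh : NormalCoh where
  sheaf := D.toModSheaf
  coherent x := ⟨nbhd x, nbhd_affine x, self_mem_nbhd x, D.toModSheaf_finGen x,
    D.toModSheaf_loc x⟩
  normal U hU a m m' h0 h := by
    rcases affine_eq hU with he | ⟨x, rfl⟩
    · exact Sec.ext fun y => absurd y.2 (he y)
    · refine Sec.ext_at (self_mem_nbhd x) le_rfl (D.normal x (a.germ ⟨x, self_mem_nbhd x⟩) _ _ ?_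
        (congrFun (congrArg Subtype.val h) ⟨x, self_mem_nbhd x⟩))
      intro h₁
      exact h0 (Sec.ext_at (self_mem_nbhd x) le_rfl h₁)

end GluingData

/-! ### Quotient sheaves -/

/-- The sections of `F` over the smallest neighbourhood of `x`, i.e. the stalk of `F` at `x`. -/
def ModSheaf.Germ (F : ModSheaf) (x : P1) : Type := F.sec (nbhd x)

instance (F : ModSheaf) (x : P1) : Zero (F.Germ x) := F.zero (nbhd x)

instance (F : ModSheaf) (x : P1) : MulActionWithZero (stalk x) (F.Germ x) :=
  MulActionWithZero.compHom (F.sec (nbhd x)) (Reg.const x)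

/-- The map from the stalk at `x` to the generic stalk. -/
def ModSheaf.gen (F : ModSheaf) (x : P1) : F.Germ x → F.Germ P1.eta := F.res (eta_nbhd_le x)

theorem Reg.const_germ (x : P1) (f : Reg (nbhd x)) :
    Reg.const x (f.germ ⟨x, self_mem_nbhd x⟩) = f :=
  Reg.ext fun y => Subtype.ext (f.2 ⟨x, self_mem_nbhd x⟩ y)

theorem ModSheaf.gen_smul (F : ModSheaf) (x : P1) (a : stalk x) (m : F.Germ x) :
    F.gen x (a • m) = Submonoid.inclusion (stalk_le_eta x) a • F.gen x m :=
  F.res_smul (eta_nbhd_le x) (Reg.const x a) m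

theorem inclusion_eq_zero {x : P1} {s : stalk x}
    (h : Submonoid.inclusion (stalk_le_eta x) s = 0) : s = 0 := by
  have h' : ((Submonoid.inclusion (stalk_le_eta x) s : stalk P1.eta) : Laurent) = 0 :=
    congrArg (Subtype.val : stalk P1.eta → Laurent) h
  exact Subtype.ext h'

theorem stalk_eta_bij {M : Type} [Zero M] [MulActionWithZero (stalk P1.eta) M]
    {a : stalk P1.eta} (ha : a ≠ 0) : Function.Bijective fun m : M => a • m := by
  have hu : IsUnit a := IsUnit.of_mul_eq_one (⟨(a : Laurent)⁻¹, trivial⟩ : stalk P1.eta)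
    (Subtype.ext (mul_inv_cancel₀ fun h => ha (Subtype.ext h)))
  obtain ⟨u, rfl⟩ := hu
  exact MulAction.bijective u

/-- The generator of the maximal ideal of the stalk: `t` at `0` and `t⁻¹` at `∞` (and `1` at
`η`). -/
def unif : (x : P1) → stalk x
  | .origin => ⟨tpow 1, Or.inr ⟨1, rfl⟩⟩
  | .infty => ⟨tpow (-1), Or.inr ⟨1, rfl⟩⟩
  | .eta => 1

theorem unif_ne (x : P1) : (unif x : Laurent) ≠ 0 := by
  cases x
  · exact WithZero.exp_ne_zero
  · exact WithZero.exp_ne_zero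
  · exact one_ne_zero

theorem eq_unif_pow {x : P1} (hx : x ≠ P1.eta) {a : stalk x} (ha : a ≠ 0) :
    ∃ k : ℕ, a = unif x ^ k := by
  have ha' : (a : Laurent) ≠ 0 := fun h => ha (Subtype.ext h)
  cases x with
  | origin =>
    obtain ⟨a, rfl | ⟨i, rfl⟩⟩ := a
    · exact absurd rfl ha'
    · refine ⟨i, Subtype.ext ?_⟩
      change tpow i = tpow 1 ^ i
      rw [← WithZero.exp_nsmul]
      simp
  | infty =>
    obtain ⟨a, rfl | ⟨i, rfl⟩⟩ := a
    · exact absurd rfl ha'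
    · refine ⟨i, Subtype.ext ?_⟩
      change tpow (-i) = tpow (-1) ^ i
      rw [← WithZero.exp_nsmul]
      simp
  | eta => exact absurd rfl hx

theorem unif_not_isUnit {x : P1} (hx : x ≠ P1.eta) : ¬ IsUnit (unif x) := by
  intro hu
  obtain ⟨b, hb⟩ := hu.exists_right_inv
  have h₁ : (unif x : Laurent) * b = 1 := congrArg Subtype.val hb
  have hb0 : b ≠ 0 := by
    rintro rfl
    exact zero_ne_one ((mul_zero (unif x : Laurent)).symm.trans h₁)
  cases x with
  | origin =>
    obtain ⟨b, rfl | ⟨i, rfl⟩⟩ := b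
    · exact hb0 rfl
    · change tpow 1 * tpow i = 1 at h₁
      rw [← WithZero.exp_add, ← WithZero.exp_zero, WithZero.exp_inj] at h₁
      omega
  | infty =>
    obtain ⟨b, rfl | ⟨i, rfl⟩⟩ := b
    · exact hb0 rfl
    · change tpow (-1) * tpow (-i) = 1 at h₁
      rw [← WithZero.exp_add, ← WithZero.exp_zero, WithZero.exp_inj] at h₁
      omega
  | eta => exact hx rfl

theorem basicOpen_unif {x : P1} (hx : x ≠ P1.eta) :
    (Reg.const x (unif x)).basicOpen = nbhd P1.eta := by
  apply le_antisymm
  · rintro y ⟨hy, hu⟩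
    rcases hy with rfl | rfl
    · exact absurd hu (unif_not_isUnit hx)
    · exact Or.inl rfl
  · apply nbhd_le
    exact ⟨Or.inr rfl, IsUnit.of_mul_eq_one
      (⟨(unif x : Laurent)⁻¹, trivial⟩ : stalk P1.eta)
      (Subtype.ext (mul_inv_cancel₀ (unif_ne x)))⟩

namespace ModSheaf

variable {F : ModSheaf}

theorem IsCoherent.loc (hF : F.IsCoherent) (x : P1) :
    IsLocalizationMap {a : stalk x | a ≠ 0} (Submonoid.inclusion (stalk_le_eta x))
      (F.gen x) := by
  have bij : ∀ s ∈ {a : stalk x | a ≠ 0}, Function.Bijective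
      fun n : F.Germ P1.eta => Submonoid.inclusion (stalk_le_eta x) s • n := fun s hs =>
    stalk_eta_bij (M := F.Germ P1.eta) fun h => hs (inclusion_eq_zero h)
  have back : ∀ m m' : F.Germ x, (∃ s ∈ {a : stalk x | a ≠ 0}, s • m = s • m') →
      F.gen x m = F.gen x m' := by
    rintro m m' ⟨s, hs, h⟩
    apply (bij s hs).1
    have h' := congrArg (F.gen x) h
    rwa [F.gen_smul, F.gen_smul] at h'
  have hone : (1 : stalk x) ≠ 0 := fun h => one_ne_zero (α := Laurent) (congrArg Subtype.val h)
  by_cases hx : x = P1.eta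
  · subst hx
    have hid : ∀ m, F.gen P1.eta m = m := F.res_refl _
    refine ⟨bij, fun n => ⟨n, 1, hone, ?_⟩, fun m m' => ⟨fun h => ⟨1, hone, ?_⟩, back m m'⟩⟩
    · rw [hid]; exact one_smul (stalk P1.eta) n
    · rw [hid, hid] at h; rw [h]
  · obtain ⟨U, hU, hxU, -, hl⟩ := hF x
    obtain rfl := affine_eq_nbhd hx hU hxU
    have key : ∀ (V : Opens P1) (h : V ≤ nbhd x), V = nbhd P1.eta →
        IsLocalizationMap (Submonoid.powers (Reg.const x (unif x)) : Set (Reg (nbhd x)))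
          (Reg.res h) (F.res h) →
        IsLocalizationMap (Submonoid.powers (Reg.const x (unif x)) : Set (Reg (nbhd x)))
          (Reg.res (eta_nbhd_le x)) (F.res (eta_nbhd_le x)) := by
      rintro V h rfl h'
      exact h'
    have hl' := key _ _ (basicOpen_unif hx) (hl (Reg.const x (unif x)))
    have hpow : ∀ k : ℕ, unif x ^ k ≠ 0 := by
      intro k h
      have h₁ : (unif x : Laurent) ^ k = 0 := congrArg Subtype.val h
      exact pow_ne_zero k (unif_ne x) h₁
    have hk : ∀ s ∈ (Submonoid.powers (Reg.const x (unif x)) : Set (Reg (nbhd x))),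
        ∃ k : ℕ, s = Reg.const x (unif x ^ k) := by
      rintro _ ⟨k, rfl⟩
      exact ⟨k, (map_pow (Reg.const x) _ k).symm⟩
    refine ⟨bij, fun n => ?_, fun m m' => ⟨fun h => ?_, back m m'⟩⟩
    · obtain ⟨m, s, hs, h⟩ := hl'.surj n
      obtain ⟨k, rfl⟩ := hk s hs
      exact ⟨m, unif x ^ k, hpow k, h⟩
    · obtain ⟨s, hs, h'⟩ := (hl'.eq_iff m m').1 h
      obtain ⟨k, rfl⟩ := hk s hs
      exact ⟨unif x ^ k, hpow k, h'⟩

theorem IsCoherent.finGen (hF : F.IsCoherent) (x : P1) : FinGen (stalk x) (F.Germ x) := by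
  classical
  have closed : ∀ y : P1, y ≠ P1.eta → FinGen (stalk y) (F.Germ y) := by
    intro y hy
    obtain ⟨U, hU, hyU, ⟨S, hS⟩, -⟩ := hF y
    obtain rfl := affine_eq_nbhd hy hU hyU
    refine ⟨S, fun m => ?_⟩
    obtain ⟨a, g, hg, h⟩ := hS m
    refine ⟨a.germ ⟨y, self_mem_nbhd y⟩, g, hg, h.trans ?_⟩
    exact congrArg (fun b : Reg (nbhd y) => b • g) (Reg.const_germ y a).symm
  by_cases hx : x = P1.eta
  · subst hx
    obtain ⟨S, hS⟩ := closed P1.origin (by simp)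
    refine ⟨S.image (F.gen P1.origin), fun n => ?_⟩
    obtain ⟨m, s, hs, h⟩ := (hF.loc P1.origin).surj n
    obtain ⟨a, g, hg, rfl⟩ := hS m
    have hs' : (s : Laurent) ≠ 0 := fun h => hs (Subtype.ext h)
    refine ⟨⟨(s : Laurent)⁻¹, trivial⟩ * Submonoid.inclusion (stalk_le_eta P1.origin) a,
      F.gen P1.origin g, Finset.mem_image_of_mem _ hg, ?_⟩
    rw [mul_smul, ← F.gen_smul, ← h, ← mul_smul]
    have h₁ : (⟨(s : Laurent)⁻¹, trivial⟩ : stalk P1.eta) *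
        Submonoid.inclusion (stalk_le_eta P1.origin) s = 1 :=
      Subtype.ext (inv_mul_cancel₀ hs')
    rw [h₁, one_smul]
  · exact closed x hx

end ModSheaf

theorem NormalCoh.germ_normal (F : NormalCoh) (x : P1) :
    NormalModule (stalk x) (F.sheaf.Germ x) := fun a m m' h0 h =>
  F.normal (nbhd x) (nbhd_affine x) (Reg.const x a) m m' h0 h

namespace CohSub

variable {F : NormalCoh} (G : CohSub F)

/-- The stalk at `x` of a coherent subsheaf, as a submodule of the stalk of the ambient sheaf. -/
def germs (x : P1) : SubMulAction (stalk x) (F.sheaf.Germ x) where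
  carrier := {m | m ∈ G.sub.sec (nbhd x)}
  smul_mem' a _ hm := (G.sub.sec (nbhd x)).smul_mem (Reg.const x a) hm

theorem gen_mem (x : P1) (m : F.sheaf.Germ x) (hm : m ∈ G.germs x) :
    F.sheaf.gen x m ∈ G.germs P1.eta := G.sub.res_mem (eta_nbhd_le x) hm

/-- If the germ of a section becomes a germ of the subsheaf at the generic point, then so does a
multiple of it at `x`. -/
theorem exists_smul_mem (x : P1) (m : F.sheaf.Germ x)
    (hm : F.sheaf.gen x m ∈ G.germs P1.eta) :
    ∃ s : stalk x, s ≠ 0 ∧ s • m ∈ G.germs x := by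
  obtain ⟨g, s, hs, h⟩ := (G.coherent.loc x).surj ⟨F.sheaf.gen x m, hm⟩
  have h₁ : Submonoid.inclusion (stalk_le_eta x) s • F.sheaf.gen x m = F.sheaf.gen x g.1 :=
    congrArg Subtype.val h
  rw [← F.sheaf.gen_smul] at h₁
  obtain ⟨r, hr, h₂⟩ := ((F.coherent.loc x).eq_iff _ _).1 h₁
  refine ⟨r * s, ?_, ?_⟩
  · intro h₃
    have h₄ : (r : Laurent) * s = 0 := congrArg Subtype.val h₃
    rcases mul_eq_zero.1 h₄ with h₅ | h₅
    · exact hr (Subtype.ext h₅)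
    · exact hs (Subtype.ext h₅)
  · rw [mul_smul, h₂]
    exact (G.germs x).smul_mem r g.2

/-- The stalks of the quotient sheaf `F / G`. -/
def quotData : GluingData where
  M x := QuotMod (G.germs x)
  ρ x := QuotMod.map (G.germs x) (G.germs P1.eta) (F.sheaf.gen x) (G.gen_mem x)
  ρ_eta q := by
    obtain ⟨m, rfl⟩ := QuotMod.mk_surj q
    exact congrArg (QuotMod.mk (G.germs P1.eta)) (F.sheaf.res_refl _ m)
  ρ_smul x a q := by
    obtain ⟨m, rfl⟩ := QuotMod.mk_surj q
    exact congrArg (QuotMod.mk (G.germs P1.eta)) (F.sheaf.gen_smul x a m)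
  loc x := by
    have bij : ∀ s ∈ {a : stalk x | a ≠ 0}, Function.Bijective
        fun n : QuotMod (G.germs P1.eta) => Submonoid.inclusion (stalk_le_eta x) s • n :=
      fun s hs => stalk_eta_bij (M := QuotMod (G.germs P1.eta))
        fun h => hs (inclusion_eq_zero h)
    refine ⟨bij, fun q => ?_, fun q q' => ?_⟩
    · obtain ⟨n, rfl⟩ := QuotMod.mk_surj q
      obtain ⟨m, s, hs, h⟩ := (F.coherent.loc x).surj n
      exact ⟨QuotMod.mk _ m, s, hs, congrArg (QuotMod.mk (G.germs P1.eta)) h⟩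
    · obtain ⟨m, rfl⟩ := QuotMod.mk_surj q
      obtain ⟨m', rfl⟩ := QuotMod.mk_surj q'
      constructor
      · intro h
        rcases QuotMod.mk_eq.1 h with h | ⟨h₁, h₂⟩
        · obtain ⟨s, hs, h'⟩ := ((F.coherent.loc x).eq_iff _ _).1 h
          exact ⟨s, hs, congrArg (QuotMod.mk (G.germs x)) h'⟩
        · obtain ⟨s, hs, h₃⟩ := G.exists_smul_mem x m h₁
          obtain ⟨s', hs', h₄⟩ := G.exists_smul_mem x m' h₂
          refine ⟨s * s', ?_, QuotMod.mk_eq.2 (Or.inr ⟨?_, ?_⟩)⟩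
          · intro h₅
            have h₆ : (s : Laurent) * s' = 0 := congrArg Subtype.val h₅
            rcases mul_eq_zero.1 h₆ with h₇ | h₇
            · exact hs (Subtype.ext h₇)
            · exact hs' (Subtype.ext h₇)
          · change (s * s') • m ∈ G.germs x
            rw [mul_comm, mul_smul]
            exact (G.germs x).smul_mem s' h₃
          · change (s * s') • m' ∈ G.germs x
            rw [mul_smul]
            exact (G.germs x).smul_mem s h₄
      · rintro ⟨s, hs, h⟩
        apply (bij s hs).1
        have e : ∀ r, Submonoid.inclusion (stalk_le_eta x) s •
            QuotMod.map (G.germs x) (G.germs P1.eta) (F.sheaf.gen x) (G.gen_mem x)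
              (QuotMod.mk (G.germs x) r) =
            QuotMod.map (G.germs x) (G.germs P1.eta) (F.sheaf.gen x) (G.gen_mem x)
              (s • QuotMod.mk (G.germs x) r) := fun r =>
          congrArg (QuotMod.mk (G.germs P1.eta)) (F.sheaf.gen_smul x s r).symm
        change Submonoid.inclusion (stalk_le_eta x) s • _ =
          Submonoid.inclusion (stalk_le_eta x) s • _
        rw [e, e, h]
  finGen x := by
    classical
    obtain ⟨S, hS⟩ := F.coherent.finGen x
    refine ⟨S.image (QuotMod.mk (G.germs x)), fun q => ?_⟩
    obtain ⟨m, rfl⟩ := QuotMod.mk_surj q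
    obtain ⟨a, g, hg, rfl⟩ := hS m
    exact ⟨a, QuotMod.mk _ g, Finset.mem_image_of_mem _ hg, rfl⟩
  normal x := by
    intro a q q' h0 h
    obtain ⟨m, rfl⟩ := QuotMod.mk_surj q
    obtain ⟨m', rfl⟩ := QuotMod.mk_surj q'
    have hz : (0 : F.sheaf.Germ x) ∈ G.germs x := G.sub.zero_mem (nbhd x)
    have hn : a • m ∉ G.germs x := fun hm => h0 (QuotMod.mk_eq.2 (Or.inr ⟨hm, hz⟩))
    rcases QuotMod.mk_eq.1 h with h | h
    · refine congrArg _ (F.germ_normal x a m m' (fun h' => hn ?_) h)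
      rw [h']
      exact hz
    · exact absurd h.1 hn

/-- The quotient sheaf `F / G`, whose stalks are the quotients of the stalks of `F` by those of
`G`: it is the sheaf associated with `U ↦ F(U) / G(U)`. -/
def quotient : NormalCoh := G.quotData.toNormalCoh

end CohSub

/-! ### The indecomposable sheaves -/

/-- Every element of `⟨t, t⁻¹⟩` is a fraction of elements of the stalk at any given point. -/
theorem exists_fraction (x : P1) (a : Laurent) :
    ∃ s m : stalk x, s ≠ 0 ∧ (s : Laurent) * a = m := by
  have hone : (1 : stalk x) ≠ 0 := fun h => one_ne_zero (α := Laurent) (congrArg Subtype.val h)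
  by_cases ha : a = 0
  · exact ⟨1, 0, hone, by rw [ha, mul_zero]; rfl⟩
  obtain ⟨k, rfl⟩ : ∃ k : ℤ, a = tpow k := ⟨WithZero.log a, (WithZero.exp_log ha).symm⟩
  cases x with
  | origin =>
    refine ⟨⟨tpow ((-k).toNat : ℕ), Or.inr ⟨_, rfl⟩⟩, ⟨tpow (k.toNat : ℕ), Or.inr ⟨_, rfl⟩⟩,
      fun h => WithZero.exp_ne_zero (congrArg Subtype.val h), ?_⟩
    change tpow _ * tpow _ = tpow _
    rw [← WithZero.exp_add]
    congr 1
    omega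
  | infty =>
    refine ⟨⟨tpow (-(k.toNat : ℕ)), Or.inr ⟨_, rfl⟩⟩, ⟨tpow (-((-k).toNat : ℕ)), Or.inr ⟨_, rfl⟩⟩,
      fun h => WithZero.exp_ne_zero (congrArg Subtype.val h), ?_⟩
    change tpow _ * tpow _ = tpow _
    rw [← WithZero.exp_add]
    congr 1
    omega
  | eta => exact ⟨1, ⟨tpow k, trivial⟩, hone, one_mul _⟩

/-- The gluing data of the line bundle `𝒪(n)`: the modules `⟨t⟩` on `U₀` and `⟨t⁻¹⟩` on `U_∞`,
glued by the automorphism `tᵏ ↦ tᵏ⁻ⁿ` of `⟨t, t⁻¹⟩`. (The generic module is identified with the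
localization of the module on `U_∞`.) -/
def lineData (n : ℤ) : GluingData where
  M x := stalk x
  ρ
    | .origin => fun m => ⟨m * tpow (-n), trivial⟩
    | .infty => fun m => ⟨m, trivial⟩
    | .eta => fun m => m
  ρ_eta _ := rfl
  ρ_smul := by
    rintro (_ | _ | _) a m
    · exact Subtype.ext (mul_assoc (a : Laurent) m _)
    · rfl
    · rfl
  loc x := by
    have hne : ∀ s : stalk x, s ≠ 0 → (s : Laurent) ≠ 0 := fun s hs h => hs (Subtype.ext h)
    have hone : (1 : stalk x) ≠ 0 := fun h => one_ne_zero (α := Laurent) (congrArg Subtype.val h)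
    refine ⟨fun s hs => stalk_eta_bij (M := stalk P1.eta) fun h => hs (inclusion_eq_zero h),
      fun q => ?_, fun m m' => ⟨fun h => ⟨1, hone, ?_⟩, ?_⟩⟩
    · cases x with
      | origin =>
        obtain ⟨s, m, hs, h⟩ := exists_fraction P1.origin ((q : Laurent) * tpow n)
        refine ⟨m, s, hs, Subtype.ext ?_⟩
        change (s : Laurent) * q = m * tpow (-n)
        rw [← h, mul_assoc, mul_assoc, ← WithZero.exp_add, add_neg_cancel, WithZero.exp_zero,
          mul_one]
      | infty =>
        obtain ⟨s, m, hs, h⟩ := exists_fraction P1.infty (q : Laurent)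
        exact ⟨m, s, hs, Subtype.ext h⟩
      | eta => exact ⟨q, 1, hone, one_smul (stalk P1.eta) q⟩
    · congr 1
      cases x with
      | origin => exact Subtype.ext (mul_right_cancel₀ WithZero.exp_ne_zero
          (congrArg (Subtype.val : stalk P1.eta → Laurent) h))
      | infty => exact Subtype.ext (congrArg (Subtype.val : stalk P1.eta → Laurent) h)
      | eta => exact h
    · rintro ⟨s, hs, h⟩
      have hm : m = m' := Subtype.ext (mul_left_cancel₀ (hne s hs)
        (congrArg (Subtype.val : stalk x → Laurent) h))
      rw [hm]
  finGen x := ⟨{1}, fun m => ⟨m, 1, Finset.mem_singleton_self _, (mul_one m).symm⟩⟩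
  normal x a m m' h0 h := by
    have ha : (a : Laurent) ≠ 0 := by
      intro h'
      apply h0
      rw [show a = 0 from Subtype.ext h']
      exact zero_smul _ _
    exact Subtype.ext (mul_left_cancel₀ ha (congrArg Subtype.val h))

/-- The line bundle `𝒪(n)`. -/
def lineBundle (n : ℤ) : NormalCoh := (lineData n).toNormalCoh

/-- At the point `x`, the ideal `{0, uⁿ, uⁿ⁺¹, …}` where `u = t` if `x = 0` and `u = t⁻¹` if
`x = ∞`; at the other two points, the unit ideal. -/
def pointIdeal (x : P1) (n : ℕ) (y : P1) : SubMulAction (stalk y) (stalk y) where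
  carrier := {a | y = x → unif y ^ n ∣ a}
  smul_mem' c _ ha h := (ha h).mul_left c

theorem zero_mem_pointIdeal (x : P1) (n : ℕ) (y : P1) : (0 : stalk y) ∈ pointIdeal x n y :=
  fun _ => dvd_zero _

theorem mem_pointIdeal_eta (x : P1) (n : ℕ) (a : stalk P1.eta) : a ∈ pointIdeal x n P1.eta := by
  intro _
  change (1 : stalk P1.eta) ^ n ∣ a
  rw [one_pow]
  exact one_dvd a

/-- The gluing data of the torsion sheaf `𝒯_{x,n}` at a closed point `x`: the module is
`⟨t⟩ / {0, tⁿ, tⁿ⁺¹, …}` at `x = 0`, resp. `⟨t⁻¹⟩ / {0, t⁻ⁿ, t⁻ⁿ⁻¹, …}` at `x = ∞`, and the modules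
at the other two points are zero. -/
def torsionData (x : P1) (n : ℕ+) : GluingData where
  M y := QuotMod (pointIdeal x n y)
  ρ y := QuotMod.map (pointIdeal x n y) (pointIdeal x n P1.eta)
    (Submonoid.inclusion (stalk_le_eta y)) (fun _ _ => mem_pointIdeal_eta x n _)
  ρ_eta q := by
    obtain ⟨m, rfl⟩ := QuotMod.mk_surj q
    rfl
  ρ_smul y a q := by
    obtain ⟨m, rfl⟩ := QuotMod.mk_surj q
    rfl
  loc y := by
    have hsub : ∀ q q' : QuotMod (pointIdeal x n P1.eta), q = q' := by
      intro q q'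
      obtain ⟨m, rfl⟩ := QuotMod.mk_surj q
      obtain ⟨m', rfl⟩ := QuotMod.mk_surj q'
      exact QuotMod.mk_eq.2 (Or.inr ⟨mem_pointIdeal_eta x n _, mem_pointIdeal_eta x n _⟩)
    have hu : ∀ a : stalk y, unif y ^ (n : ℕ) • a ∈ pointIdeal x n y := fun a _ => dvd_mul_right _ _
    refine ⟨fun s hs => ⟨fun q q' _ => hsub q q', fun q => ⟨q, hsub _ _⟩⟩,
      fun q => ⟨0, 1, ?_, hsub _ _⟩, fun q q' => ⟨fun _ => ⟨unif y ^ (n : ℕ), ?_, ?_⟩,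
        fun _ => hsub _ _⟩⟩
    · exact fun h => one_ne_zero (α := Laurent) (congrArg Subtype.val h)
    · exact fun h => pow_ne_zero (n : ℕ) (unif_ne y) (congrArg Subtype.val h)
    · obtain ⟨m, rfl⟩ := QuotMod.mk_surj q
      obtain ⟨m', rfl⟩ := QuotMod.mk_surj q'
      exact QuotMod.mk_eq.2 (Or.inr ⟨hu m, hu m'⟩)
  finGen y := by
    classical
    refine ⟨{QuotMod.mk _ 1}, fun q => ?_⟩
    obtain ⟨m, rfl⟩ := QuotMod.mk_surj q
    refine ⟨m, _, Finset.mem_singleton_self _, ?_⟩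
    rw [QuotMod.smul_mk]
    exact congrArg _ (mul_one m).symm
  normal y := by
    intro a q q' h0 h
    obtain ⟨m, rfl⟩ := QuotMod.mk_surj q
    obtain ⟨m', rfl⟩ := QuotMod.mk_surj q'
    have hz : (0 : stalk y) ∈ pointIdeal x n y := zero_mem_pointIdeal x n y
    have hn : a • m ∉ pointIdeal x n y := fun hm => h0 (QuotMod.mk_eq.2 (Or.inr ⟨hm, hz⟩))
    rcases QuotMod.mk_eq.1 h with h | h
    · have ha : (a : Laurent) ≠ 0 := by
        intro h'
        apply hn
        rw [show a = 0 from Subtype.ext h', zero_smul]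
        exact hz
      exact congrArg _ (Subtype.ext (mul_left_cancel₀ ha (congrArg Subtype.val h)))
    · exact absurd h.1 hn

/-- The torsion sheaf `𝒯_{x,n}` at a closed point `x`. -/
def torsionSheaf (x : P1) (n : ℕ+) : NormalCoh := (torsionData x n).toNormalCoh

/-- The pointed set `{*} ∪ ℤ/n`, with elements `z_i` for `i ∈ ℤ/n`. -/
def CycMod (n : ℕ+) : Type := WithZero (Multiplicative (ZMod n))

namespace CycMod

variable {n : ℕ+}

/-- The element `z_i`. -/
def z (i : ZMod n) : CycMod n := ((Multiplicative.ofAdd i : Multiplicative (ZMod n)) :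
  WithZero (Multiplicative (ZMod n)))

instance : Zero (CycMod n) := inferInstanceAs (Zero (WithZero (Multiplicative (ZMod n))))

instance : MulActionWithZero (WithZero (Multiplicative (ZMod n))) (CycMod n) :=
  inferInstanceAs (MulActionWithZero (WithZero (Multiplicative (ZMod n)))
    (WithZero (Multiplicative (ZMod n))))

/-- The reduction `tᵏ ↦ k mod n`, as a map of monoids with zero. -/
def reduce (n : ℕ+) : Laurent →*₀ WithZero (Multiplicative (ZMod n)) :=
  WithZero.map' (AddMonoidHom.toMultiplicative (Int.castAddHom (ZMod n)))

/-- The action of `⟨t, t⁻¹⟩` on `{*} ∪ ℤ/n`, with `tᵏ • z_i = z_{i + k}`. -/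
instance : MulActionWithZero Laurent (CycMod n) :=
  MulActionWithZero.compHom (CycMod n) (reduce n)

/-- The inclusion of a stalk into `⟨t, t⁻¹⟩`. -/
def incl (x : P1) : stalk x →*₀ Laurent where
  toFun a := a
  map_zero' := rfl
  map_one' := rfl
  map_mul' _ _ := rfl

instance (x : P1) : MulActionWithZero (stalk x) (CycMod n) :=
  MulActionWithZero.compHom (CycMod n) (incl x)

theorem tpow_smul_z (k : ℤ) (i : ZMod n) : tpow k • z i = z (i + (k : ZMod n)) := by
  rw [add_comm]
  rfl

theorem stalk_smul {x : P1} (a : stalk x) (m : CycMod n) : a • m = (a : Laurent) • m := rfl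

theorem cases (m : CycMod n) : m = 0 ∨ ∃ i, m = z i := by
  induction m using WithZero.recZeroCoe with
  | zero => exact Or.inl rfl
  | coe a => exact Or.inr ⟨a.toAdd, rfl⟩

theorem smul_inj {x : P1} {a : stalk x} (ha : a ≠ 0) {m m' : CycMod n} (h : a • m = a • m') :
    m = m' := by
  have ha' : (a : Laurent) ≠ 0 := fun h => ha (Subtype.ext h)
  have h' : (a : Laurent)⁻¹ • (a : Laurent) • m = (a : Laurent)⁻¹ • (a : Laurent) • m' :=
    congrArg ((a : Laurent)⁻¹ • ·) h
  rwa [← mul_smul, ← mul_smul, inv_mul_cancel₀ ha', one_smul, one_smul] at h'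

end CycMod

/-- The gluing data of the cyclic sheaf `𝒞_n`: a directed cycle with `n` vertices on `U₀` and on
`U_∞`, glued by the identity. -/
def cyclicData (n : ℕ+) : GluingData where
  M _ := CycMod n
  ρ _ m := m
  ρ_eta _ := rfl
  ρ_smul _ _ _ := rfl
  loc x := by
    have hone : (1 : stalk x) ≠ 0 := fun h => one_ne_zero (α := Laurent) (congrArg Subtype.val h)
    refine ⟨fun s hs => stalk_eta_bij (M := CycMod n) fun h => hs (inclusion_eq_zero h),
      fun q => ⟨q, 1, hone, one_smul (stalk x) q⟩, fun m m' => ⟨fun h => ⟨1, hone, ?_⟩, ?_⟩⟩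
    · rw [h]
    · rintro ⟨s, hs, h⟩
      exact CycMod.smul_inj hs h
  finGen x := by
    refine ⟨{CycMod.z 0}, fun m => ?_⟩
    rcases CycMod.cases m with rfl | ⟨i, rfl⟩
    · exact ⟨0, _, Finset.mem_singleton_self _, (zero_smul (stalk x) _).symm⟩
    have hi : ((i.val : ℤ) : ZMod n) = i := by simp
    have hi' : ((-((-i).val : ℤ) : ℤ) : ZMod n) = i := by simp
    cases x with
    | origin =>
      refine ⟨⟨tpow (i.val : ℕ), Or.inr ⟨_, rfl⟩⟩, _, Finset.mem_singleton_self _, ?_⟩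
      refine Eq.trans ?_ (CycMod.tpow_smul_z _ _).symm
      rw [hi, zero_add]
    | infty =>
      refine ⟨⟨tpow (-((-i).val : ℕ)), Or.inr ⟨_, rfl⟩⟩, _, Finset.mem_singleton_self _, ?_⟩
      refine Eq.trans ?_ (CycMod.tpow_smul_z _ _).symm
      rw [hi', zero_add]
    | eta =>
      refine ⟨⟨tpow (i.val : ℕ), trivial⟩, _, Finset.mem_singleton_self _, ?_⟩
      refine Eq.trans ?_ (CycMod.tpow_smul_z _ _).symm
      rw [hi, zero_add]
  normal x a m m' h0 h := by
    refine CycMod.smul_inj (fun ha => h0 ?_) h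
    rw [ha]
    exact zero_smul (stalk x) m

/-- The cyclic sheaf `𝒞_n`. -/
def cyclicSheaf (n : ℕ+) : NormalCoh := (cyclicData n).toNormalCoh

/-! ### The Hall algebra -/

/-- Isomorphism of normal coherent sheaves. (An isomorphism of sheaves of modules is bijective on
sections, hence automatically normal.) -/
instance isoSetoid : Setoid NormalCoh where
  r F G := Nonempty (ModSheaf.Iso F.sheaf G.sheaf)
  iseqv :=
    { refl := fun _ => ⟨⟨fun _ => Equiv.refl _, fun _ _ _ => rfl, fun _ _ => rfl⟩⟩
      symm := by
        rintro F G ⟨e⟩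
        refine ⟨⟨fun U => (e.toEquiv U).symm, fun U a s => ?_, fun h s => ?_⟩⟩
        · rw [Equiv.symm_apply_eq, e.map_smul, Equiv.apply_symm_apply]
        · rw [Equiv.symm_apply_eq, e.map_res, Equiv.apply_symm_apply]
      trans := by
        rintro F G H ⟨e⟩ ⟨e'⟩
        refine ⟨⟨fun U => (e.toEquiv U).trans (e'.toEquiv U), fun U a s => ?_, fun h s => ?_⟩⟩
        · simp only [Equiv.trans_apply, e.map_smul, e'.map_smul]
        · simp only [Equiv.trans_apply, e.map_res, e'.map_res] }

/-- The set of isomorphism classes of normal coherent sheaves on `ℙ¹`. -/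
def IsoClass : Type 1 := Quotient isoSetoid

/-- The isomorphism class of a normal coherent sheaf. -/
def isoClass (F : NormalCoh) : IsoClass := Quotient.mk isoSetoid F

/-- The underlying vector space of the Hall algebra: finitely supported functions on the set of
isomorphism classes. -/
abbrev Hall : Type 1 := IsoClass →₀ ℂ

/-- The delta function `δ_F` of the isomorphism class of `F`. -/
noncomputable def delta (F : NormalCoh) : Hall := Finsupp.single (isoClass F) 1

/-- `p` is the convolution product `f ⋆ g` in the Hall algebra: for every `F`,
`p(F) = ∑_{F' ⊆ F} f(F / F') g(F')`, where the sum is over all coherent subsheaves `F'` of `F` and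
has only finitely many nonzero terms. -/
structure IsHallProduct (f g p : Hall) : Prop where
  finite : ∀ F : NormalCoh,
    {F' : CohSub F | f (isoClass F'.quotient) * g (isoClass F'.toNormalCoh) ≠ 0}.Finite
  eq_sum : ∀ F : NormalCoh, p (isoClass F) =
    ∑ᶠ F' : CohSub F, f (isoClass F'.quotient) * g (isoClass F'.toNormalCoh)

/-- `c` is the commutator `[f, g] = f ⋆ g - g ⋆ f` in the Hall algebra; in particular both products
exist. -/
def IsHallCommutator (f g c : Hall) : Prop :=
  ∃ p q : Hall, IsHallProduct f g p ∧ IsHallProduct g f q ∧ c = p - q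

end PLine

/-! A normal coherent sheaf on the projective line amounts to its three stalks with the maps to the
generic stalk, which is a localization of each; coherent subsheaves and quotients are computed stalk
by stalk. The value of the product of the delta functions of `A` and `B` at `F` is the number of
subsheaves `G` of `F` with `G ≅ B` and `F / G ≅ A`.

The decisive notion is `IsSplit`: `G` splits off if no element outside `G` has a nonzero multiple in
`G`. Then the elements outside `G`, together with the base point, form a subsheaf, isomorphic to `F
/ G`, and `F` is the wedge of the two. Unlike for modules over a ring, this complement is canonical,
and taking it is an involution. It exchanges the split subsheaves counted for `(A, B)` with those
counted for `(B, A)` (`splitSet_ncard_comm`), so the split part of a product is symmetric and only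
nonsplit extensions contribute to a commutator. Finiteness comes along: a split subsheaf is
determined by the generators of `F` that it contains, and the split extension of `A` by `B` is
unique up to isomorphism.

A subsheaf splits off if the quotient is torsion-free or if the subsheaf is divisible. Line bundles
are torsion-free and cyclic sheaves are both, which settles relations 1 and 4. Torsion sheaves at
different points have disjoint supports, so there too everything splits.

What remains are the extensions of `𝒯_{x,n}` by `𝒯_{x,k}` or by `𝒪(m)`. Let `u` be the uniformizer
at `x` and `r` a lift of the generator of the quotient. If the extension does not split, normality
forces `uⁿ r` to be the generator of the subsheaf at `x`, so `F` has cyclic stalks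
(`exists_generators_of_not_isSplit`) and must be `𝒯_{x,n+k}`, resp. `𝒪(m+n)`. In such an `F` the
subsheaf `uⁿ F` is the only one with quotient `𝒯_{x,n}` (`eq_powSub`). For two torsion sheaves at
`x` the exceptional sheaf thus contributes `1 - 1 = 0`. For `𝒯_{x,n}` and `𝒪(m)` it contributes `1 -
0`, because a line bundle has no torsion subsheaf; this is the term `𝒪(m+n)`. -/

namespace PLine

/-! ### Isomorphisms of gluing data -/

/-- An isomorphism of gluing data. -/
structure DataIso (D D' : GluingData) where
  e : ∀ x, D.M x ≃ D'.M x
  map_smul : ∀ x (a : stalk x) (m : D.M x), e x (a • m) = a • e x m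
  map_ρ : ∀ x (m : D.M x), D'.ρ x (e x m) = e P1.eta (D.ρ x m)

namespace DataIso

variable {D D' D'' : GluingData}

theorem map_zero (i : DataIso D D') (x : P1) : i.e x 0 = 0 := by
  have h := i.map_smul x 0 0
  rw [zero_smul, zero_smul] at h
  exact h

theorem map_eq_zero (i : DataIso D D') {x : P1} {m : D.M x} : i.e x m = 0 ↔ m = 0 := by
  rw [← i.map_zero x, (i.e x).apply_eq_iff_eq]

def symm (i : DataIso D D') : DataIso D' D where
  e x := (i.e x).symm
  map_smul x a m := by rw [Equiv.symm_apply_eq, i.map_smul, Equiv.apply_symm_apply]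
  map_ρ x m := by
    rw [eq_comm, Equiv.symm_apply_eq, ← i.map_ρ, Equiv.apply_symm_apply]

def trans (i : DataIso D D') (j : DataIso D' D'') : DataIso D D'' where
  e x := (i.e x).trans (j.e x)
  map_smul x a m := by simp only [Equiv.trans_apply, i.map_smul, j.map_smul]
  map_ρ x m := by simp only [Equiv.trans_apply, i.map_ρ, j.map_ρ]

/-- A family of compatible bijective linear maps is an isomorphism. -/
noncomputable def ofBijective (f : ∀ x, D.M x → D'.M x) (hf : ∀ x, Function.Bijective (f x))
    (hs : ∀ x (a : stalk x) (m : D.M x), f x (a • m) = a • f x m)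
    (hr : ∀ x (m : D.M x), D'.ρ x (f x m) = f P1.eta (D.ρ x m)) : DataIso D D' where
  e x := Equiv.ofBijective (f x) (hf x)
  map_smul := hs
  map_ρ := hr

/-- An isomorphism of gluing data induces an isomorphism of the glued sheaves. -/
def toIso (i : DataIso D D') : ModSheaf.Iso D.toModSheaf D'.toModSheaf where
  toEquiv U :=
    { toFun := fun s => ⟨fun x => i.e x (s.1 x), fun x => by rw [i.map_ρ, s.2 x]⟩
      invFun := fun s => ⟨fun x => (i.e x).symm (s.1 x), fun x =>
        (i.symm.map_ρ x (s.1 x)).trans (congrArg (i.e P1.eta).symm (s.2 x))⟩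
      left_inv := fun s => GluingData.Sec.ext fun x => (i.e x).symm_apply_apply _
      right_inv := fun s => GluingData.Sec.ext fun x => (i.e x).apply_symm_apply _ }
  map_smul U a s := GluingData.Sec.ext fun x => i.map_smul x _ _
  map_res h s := rfl

end DataIso

/-! ### Sections in terms of germs -/

theorem eq_iSup_nbhd (U : Opens P1) : U = ⨆ x : U, nbhd x := by
  apply le_antisymm
  · intro x hx
    exact Opens.mem_iSup.2 ⟨⟨x, hx⟩, self_mem_nbhd x⟩
  · exact iSup_le fun x => nbhd_le x.2

theorem nbhd_inf_le {x y : P1} (h : x ≠ y) : nbhd x ⊓ nbhd y ≤ nbhd P1.eta := by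
  rintro z ⟨hx | hz, hy | hz⟩
  · exact absurd (hx.symm.trans hy) h
  all_goals exact Or.inl hz

namespace ModSheaf

variable {F G : ModSheaf}

/-- Every point has a smallest neighbourhood, and two different ones meet inside `{η}`. Gluing germs
therefore only requires that each of them restrict to the given germ at `η`. -/
theorem existsUnique_section (F : ModSheaf) {U : Opens P1} (s : ∀ x : U, F.Germ x)
    (hs : ∀ x : U, F.gen x (s x) = s ⟨P1.eta, eta_mem x.2⟩) :
    ∃! t : F.sec U, ∀ x : U, F.res (nbhd_le x.2) t = s x := by
  -- The open set `U` and the union of the neighbourhoods are equal but not definitionally so; a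
  -- variable `V` allows sections to be moved between them by substitution.
  have key : ∀ (V : Opens P1) (h : V = ⨆ x : U, nbhd x), ∃! t : F.sec V, ∀ x : U,
      F.res ((le_iSup (fun x : U => nbhd x) x).trans h.ge) t = s x := by
    rintro V rfl
    refine F.glue (fun x : U => nbhd x) s fun x y => ?_
    by_cases hxy : x = y
    · subst hxy
      rfl
    · have h := nbhd_inf_le fun h => hxy (Subtype.ext h)
      exact (F.res_res h (eta_nbhd_le x) (s x)).symm.trans
        ((congrArg (F.res h) ((hs x).trans (hs y).symm)).trans
          (F.res_res h (eta_nbhd_le y) (s y)))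
  exact key U (eq_iSup_nbhd U)

theorem gen_res (F : ModSheaf) {U : Opens P1} (t : F.sec U) {x : P1} (hx : x ∈ U) :
    F.gen x (F.res (nbhd_le hx) t) = F.res (nbhd_le (eta_mem hx)) t :=
  F.res_res _ _ _

theorem sec_ext {U : Opens P1} {s t : F.sec U}
    (h : ∀ x (hx : x ∈ U), F.res (nbhd_le hx) s = F.res (nbhd_le hx) t) : s = t := by
  obtain ⟨r, -, hr⟩ := F.existsUnique_section (U := U) (fun x => F.res (nbhd_le x.2) t)
    fun x => F.gen_res t x.2
  exact (hr s fun x => h x x.2).trans (hr t fun x => rfl).symm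

/-- The stalks of a sheaf, as gluing data. -/
def germGluing (F : ModSheaf)
    (loc : ∀ x, IsLocalizationMap {a : stalk x | a ≠ 0} (Submonoid.inclusion (stalk_le_eta x))
      (F.gen x))
    (finGen : ∀ x, FinGen (stalk x) (F.Germ x))
    (normal : ∀ x, NormalModule (stalk x) (F.Germ x)) : GluingData where
  M := F.Germ
  ρ := F.gen
  ρ_eta := F.res_refl _
  ρ_smul := F.gen_smul
  loc := loc
  finGen := finGen
  normal := normal

/-- A sheaf is glued from its stalks. -/
noncomputable def isoGlued (F : ModSheaf)
    (loc : ∀ x, IsLocalizationMap {a : stalk x | a ≠ 0} (Submonoid.inclusion (stalk_le_eta x))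
      (F.gen x))
    (finGen : ∀ x, FinGen (stalk x) (F.Germ x))
    (normal : ∀ x, NormalModule (stalk x) (F.Germ x)) :
    Iso F (F.germGluing loc finGen normal).toModSheaf where
  toEquiv U := Equiv.ofBijective
    (fun s => (⟨fun x => F.res (nbhd_le x.2) s, fun x => F.gen_res s x.2⟩ :
      (F.germGluing loc finGen normal).Sec U))
    ⟨fun s t h => sec_ext fun x hx => congrFun (congrArg Subtype.val h) ⟨x, hx⟩, fun s => by
      obtain ⟨t, ht, -⟩ := F.existsUnique_section s.1 s.2
      exact ⟨t, GluingData.Sec.ext ht⟩⟩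
  map_smul U a s := GluingData.Sec.ext fun x => by
    refine (F.res_smul (nbhd_le x.2) a s).trans ?_
    have h : Reg.res (nbhd_le x.2) a = Reg.const x (a.germ x) := by
      refine Reg.ext fun y => Subtype.ext ?_
      exact a.2 ⟨y, nbhd_le x.2 y.2⟩ x
    rw [h]
    rfl
  map_res h s := GluingData.Sec.ext fun x => F.res_res _ _ _

/-- Coherence is invariant under isomorphism. -/
theorem Iso.isCoherent (e : Iso F G) (hF : F.IsCoherent) : G.IsCoherent := by
  classical
  intro x
  obtain ⟨U, hU, hx, ⟨S, hS⟩, hl⟩ := hF x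
  refine ⟨U, hU, hx, ⟨S.image (e.toEquiv U), fun m => ?_⟩, fun f => ?_⟩
  · obtain ⟨a, g, hg, h⟩ := hS ((e.toEquiv U).symm m)
    refine ⟨a, _, Finset.mem_image_of_mem _ hg, ?_⟩
    rw [← e.map_smul, ← h, Equiv.apply_symm_apply]
  · have h := hl f
    refine ⟨fun s hs => ?_, fun n => ?_, fun m m' => ?_⟩
    · have h₁ : (fun n : G.sec f.basicOpen => Reg.res f.basicOpen_le s • n) =
          (e.toEquiv _) ∘ (fun n : F.sec f.basicOpen => Reg.res f.basicOpen_le s • n) ∘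
            (e.toEquiv _).symm := by
        funext n
        simp only [Function.comp_apply, e.map_smul, Equiv.apply_symm_apply]
      rw [h₁]
      exact (e.toEquiv _).bijective.comp ((h.bij s hs).comp (e.toEquiv _).symm.bijective)
    · obtain ⟨m, s, hs, h₁⟩ := h.surj ((e.toEquiv _).symm n)
      refine ⟨e.toEquiv _ m, s, hs, ?_⟩
      rw [← e.map_res, ← h₁, e.map_smul, Equiv.apply_symm_apply]
    · have h₁ := h.eq_iff ((e.toEquiv _).symm m) ((e.toEquiv _).symm m')
      have h₂ : ∀ m, G.res f.basicOpen_le m =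
          e.toEquiv _ (F.res f.basicOpen_le ((e.toEquiv _).symm m)) := fun m => by
        rw [e.map_res, Equiv.apply_symm_apply]
      have h₃ : ∀ (s : Reg U) m, s • m = e.toEquiv _ (s • (e.toEquiv _).symm m) := fun s m => by
        rw [e.map_smul, Equiv.apply_symm_apply]
      rw [h₂ m, h₂ m', (e.toEquiv _).apply_eq_iff_eq, h₁]
      refine exists_congr fun s => and_congr_right fun _ => ?_
      rw [h₃ s m, h₃ s m', (e.toEquiv _).apply_eq_iff_eq]

/-- Coherence can be tested on stalks. -/
theorem isCoherent_of_germs (F : ModSheaf)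
    (loc : ∀ x, IsLocalizationMap {a : stalk x | a ≠ 0} (Submonoid.inclusion (stalk_le_eta x))
      (F.gen x))
    (finGen : ∀ x, FinGen (stalk x) (F.Germ x))
    (normal : ∀ x, NormalModule (stalk x) (F.Germ x)) : F.IsCoherent := by
  let i := F.isoGlued loc finGen normal
  refine Iso.isCoherent (F := (F.germGluing loc finGen normal).toModSheaf)
    ⟨fun U => (i.toEquiv U).symm, fun U a s => ?_, fun h s => ?_⟩
    (F.germGluing loc finGen normal).toNormalCoh.coherent
  · rw [Equiv.symm_apply_eq, i.map_smul, Equiv.apply_symm_apply]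
  · rw [Equiv.symm_apply_eq, i.map_res, Equiv.apply_symm_apply]

end ModSheaf

/-! ### Isomorphism classes in terms of stalks -/

namespace NormalCoh

/-- The stalks of a normal coherent sheaf, as gluing data. -/
def germData (F : NormalCoh) : GluingData :=
  F.sheaf.germGluing F.coherent.loc F.coherent.finGen F.germ_normal

theorem isoClass_germData (F : NormalCoh) : isoClass F.germData.toNormalCoh = isoClass F :=
  (Quotient.sound ⟨F.sheaf.isoGlued F.coherent.loc F.coherent.finGen F.germ_normal⟩ :
    isoClass F = _).symm

end NormalCoh

/-- The stalks of a glued sheaf are the modules from which it is glued. -/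
noncomputable def GluingData.germIso (D : GluingData) : DataIso D.toNormalCoh.germData D :=
  DataIso.ofBijective (D := D.toNormalCoh.germData)
    (fun x (s : D.Sec (nbhd x)) => s.1 ⟨x, self_mem_nbhd x⟩)
    (fun x => ⟨fun _ _ h => Sec.ext_at (self_mem_nbhd x) le_rfl h, fun m => Sec.exists_germ m⟩)
    (fun _ _ _ => rfl) (fun x (s : D.Sec (nbhd x)) => s.2 ⟨x, self_mem_nbhd x⟩)

/-- An isomorphism of sheaves restricts to the smallest neighbourhoods, and conversely a sheaf is
glued from its stalks. This reduces all later questions about isomorphism classes to the three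
stalks. -/
theorem isoClass_eq_iff {F F' : NormalCoh} :
    isoClass F = isoClass F' ↔ Nonempty (DataIso F.germData F'.germData) := by
  constructor
  · intro h
    obtain ⟨e⟩ := Quotient.exact h
    exact ⟨⟨fun x => e.toEquiv (nbhd x), fun x a m => e.map_smul _ (Reg.const x a) m,
      fun x m => (e.map_res (eta_nbhd_le x) m).symm⟩⟩
  · rintro ⟨i⟩
    rw [← F.isoClass_germData, ← F'.isoClass_germData]
    exact Quotient.sound ⟨i.toIso⟩

theorem isoClass_glued_eq_iff {D : GluingData} {F : NormalCoh} :
    isoClass D.toNormalCoh = isoClass F ↔ Nonempty (DataIso D F.germData) := by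
  rw [isoClass_eq_iff]
  exact ⟨fun ⟨i⟩ => ⟨D.germIso.symm.trans i⟩, fun ⟨i⟩ => ⟨D.germIso.trans i⟩⟩

theorem isoClass_glued_eq_glued_iff {D D' : GluingData} :
    isoClass D.toNormalCoh = isoClass D'.toNormalCoh ↔ Nonempty (DataIso D D') := by
  rw [isoClass_glued_eq_iff]
  exact ⟨fun ⟨i⟩ => ⟨i.trans D'.germIso⟩, fun ⟨i⟩ => ⟨i.trans D'.germIso.symm⟩⟩

/-! ### Coherent subsheaves in terms of germs -/

namespace CohSub

variable {F : NormalCoh}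

/-- By the locality axiom for subsheaves, a section belongs to the subsheaf as soon as all its germs
do. -/
theorem ext_germs {G H : CohSub F} (h : ∀ x m, m ∈ G.germs x ↔ m ∈ H.germs x) : G = H := by
  have key : ∀ (G : CohSub F) (U : Opens P1) (s : F.sheaf.sec U),
      s ∈ G.sub.sec U ↔ ∀ x (hx : x ∈ U), F.sheaf.res (nbhd_le hx) s ∈ G.germs x := by
    intro G U s
    refine ⟨fun hs x hx => G.sub.res_mem (nbhd_le hx) hs, fun hs => ?_⟩
    have loc : ∀ (V : Opens P1) (h : V = ⨆ x : U, nbhd x) (s : F.sheaf.sec V),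
        (∀ x : U, F.sheaf.res ((le_iSup (fun x : U => nbhd x) x).trans h.ge) s ∈
          G.sub.sec (nbhd x)) → s ∈ G.sub.sec V := by
      rintro V rfl s hs
      exact G.sub.local_mem _ s hs
    exact loc U (eq_iSup_nbhd U) s fun x => hs x x.2
  have hsec : G.sub.sec = H.sub.sec := by
    funext U
    refine SetLike.ext fun s => ?_
    rw [key G, key H]
    exact forall₂_congr fun x hx => h x _
  obtain ⟨⟨s, _, _, _⟩, _⟩ := G
  obtain ⟨⟨s', _, _, _⟩, _⟩ := H
  obtain rfl : s = s' := hsec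
  rfl

/-- The subsheaf with given stalks. -/
def subOfGerms (F : NormalCoh) (N : ∀ x, SubMulAction (stalk x) (F.sheaf.Germ x))
    (zero_mem : ∀ x, 0 ∈ N x) : SubModSheaf F.sheaf where
  sec U :=
    { carrier := {s | ∀ x (hx : x ∈ U), (F.sheaf.res (nbhd_le hx) s : F.sheaf.Germ x) ∈ N x}
      smul_mem' := fun a s hs x hx => by
        have h : Reg.res (nbhd_le hx) a = Reg.const x (a.germ ⟨x, hx⟩) :=
          Reg.ext fun y => Subtype.ext (a.2 ⟨y, nbhd_le hx y.2⟩ ⟨x, hx⟩)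
        rw [F.sheaf.res_smul, h]
        exact (N x).smul_mem _ (hs x hx) }
  zero_mem U x hx := by
    rw [F.sheaf.res_zero]
    exact zero_mem x
  res_mem h s hs x hx := by
    rw [F.sheaf.res_res]
    exact hs x (h hx)
  local_mem W s hs x hx := by
    obtain ⟨i, hi⟩ := Opens.mem_iSup.1 hx
    have h := hs i x hi
    rwa [F.sheaf.res_res] at h

/-- A section over the smallest neighbourhood of `x` is tested at `x` and at `η`; the hypothesis
`gen_mem` makes the second test automatic. -/
theorem mem_subOfGerms {N : ∀ x, SubMulAction (stalk x) (F.sheaf.Germ x)}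
    {zero_mem : ∀ x, 0 ∈ N x} (gen_mem : ∀ x, ∀ m ∈ N x, F.sheaf.gen x m ∈ N P1.eta)
    {x : P1} {m : F.sheaf.Germ x} :
    m ∈ (subOfGerms F N zero_mem).sec (nbhd x) ↔ m ∈ N x := by
  constructor
  · intro h
    have h₁ := h x (self_mem_nbhd x)
    have h₂ : F.sheaf.res (nbhd_le (self_mem_nbhd x)) m = m := F.sheaf.res_refl _ m
    exact h₂ ▸ h₁
  · rintro h y (rfl | rfl)
    · have h₂ : F.sheaf.res (nbhd_le (self_mem_nbhd y)) m = m := F.sheaf.res_refl _ m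
      exact h₂.symm ▸ h
    · exact gen_mem x m h

/-- The coherent subsheaf with given stalks. -/
def ofGerms (F : NormalCoh) (N : ∀ x, SubMulAction (stalk x) (F.sheaf.Germ x))
    (zero_mem : ∀ x, 0 ∈ N x) (gen_mem : ∀ x, ∀ m ∈ N x, F.sheaf.gen x m ∈ N P1.eta)
    (finGen : ∀ x, ∃ S : Finset (F.sheaf.Germ x), (∀ g ∈ S, g ∈ N x) ∧
      ∀ m ∈ N x, ∃ a : stalk x, ∃ g ∈ S, m = a • g)
    (surj : ∀ x, ∀ n ∈ N P1.eta, ∃ m ∈ N x, ∃ s : stalk x, s ≠ 0 ∧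
      Submonoid.inclusion (stalk_le_eta x) s • n = F.sheaf.gen x m) : CohSub F where
  sub := subOfGerms F N zero_mem
  coherent := by
    classical
    refine ModSheaf.isCoherent_of_germs _ (fun x => ⟨fun s hs => ?_, fun n => ?_,
      fun m m' => ?_⟩) (fun x => ?_) (fun x a m m' h0 h => ?_)
    · exact stalk_eta_bij (M := (subOfGerms F N zero_mem).toModSheaf.Germ P1.eta)
        fun h => hs (inclusion_eq_zero h)
    · obtain ⟨m, hm, s, hs, h⟩ := surj x n.1 ((mem_subOfGerms gen_mem).1 n.2)
      exact ⟨⟨m, (mem_subOfGerms gen_mem).2 hm⟩, s, hs, Subtype.ext h⟩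
    · have h := (F.coherent.loc x).eq_iff m.1 m'.1
      constructor
      · intro h'
        obtain ⟨s, hs, h₁⟩ := h.1 (congrArg Subtype.val h')
        exact ⟨s, hs, Subtype.ext h₁⟩
      · rintro ⟨s, hs, h'⟩
        exact Subtype.ext (h.2 ⟨s, hs, congrArg Subtype.val h'⟩)
    · obtain ⟨S, hS, h⟩ := finGen x
      refine ⟨S.attach.image fun g => ⟨g.1, (mem_subOfGerms gen_mem).2 (hS g.1 g.2)⟩, fun m => ?_⟩
      obtain ⟨a, g, hg, hm⟩ := h m.1 ((mem_subOfGerms gen_mem).1 m.2)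
      exact ⟨a, _, Finset.mem_image_of_mem _ (Finset.mem_attach S ⟨g, hg⟩), Subtype.ext hm⟩
    · exact Subtype.ext (F.germ_normal x a m.1 m'.1 (fun h' => h0 (Subtype.ext h'))
        (congrArg Subtype.val h))

theorem mem_germs_ofGerms {N : ∀ x, SubMulAction (stalk x) (F.sheaf.Germ x)}
    {zero_mem : ∀ x, 0 ∈ N x} {gen_mem : ∀ x, ∀ m ∈ N x, F.sheaf.gen x m ∈ N P1.eta}
    {finGen : ∀ x, ∃ S : Finset (F.sheaf.Germ x), (∀ g ∈ S, g ∈ N x) ∧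
      ∀ m ∈ N x, ∃ a : stalk x, ∃ g ∈ S, m = a • g}
    {surj : ∀ x, ∀ n ∈ N P1.eta, ∃ m ∈ N x, ∃ s : stalk x, s ≠ 0 ∧
      Submonoid.inclusion (stalk_le_eta x) s • n = F.sheaf.gen x m}
    {x : P1} {m : F.sheaf.Germ x} :
    m ∈ (ofGerms F N zero_mem gen_mem finGen surj).germs x ↔ m ∈ N x :=
  mem_subOfGerms (zero_mem := zero_mem) gen_mem

theorem zero_mem_germs (G : CohSub F) (x : P1) : 0 ∈ G.germs x := G.sub.zero_mem (nbhd x)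

end CohSub

/-! ### Subsheaves that split off and their complements -/

theorem stalk_mul_ne_zero {x : P1} {a b : stalk x} (ha : a ≠ 0) (hb : b ≠ 0) : a * b ≠ 0 := by
  intro h
  rcases mul_eq_zero.1 (congrArg Subtype.val h : (a : Laurent) * b = 0) with h | h
  · exact ha (Subtype.ext h)
  · exact hb (Subtype.ext h)

theorem NormalCoh.gen_zero (F : NormalCoh) (x : P1) : F.sheaf.gen x 0 = 0 :=
  F.sheaf.res_zero _

/-- A generic germ that is killed by a nonzero element vanishes. -/
theorem eq_zero_of_inclusion_smul {M : Type} [Zero M] [MulActionWithZero (stalk P1.eta) M] {x : P1}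
    {s : stalk x} (hs : s ≠ 0) {n : M} (h : Submonoid.inclusion (stalk_le_eta x) s • n = 0) :
    n = 0 :=
  (stalk_eta_bij (M := M) fun h => hs (inclusion_eq_zero h)).1 (h.trans (smul_zero _).symm)

namespace CohSub

variable {F F' : NormalCoh}

theorem mk_eq_zero {G : CohSub F} {x : P1} {m : F.sheaf.Germ x} :
    QuotMod.mk (G.germs x) m = 0 ↔ m ∈ G.germs x := by
  rw [QuotMod.zero_def, QuotMod.mk_eq]
  constructor
  · rintro (rfl | h)
    · exact G.zero_mem_germs x
    · exact h.1
  · exact fun h => Or.inr ⟨h, G.zero_mem_germs x⟩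

/-- The subsheaf `G` splits off: no element outside of `G` has a nonzero multiple in `G`. -/
def IsSplit (G : CohSub F) : Prop :=
  ∀ (x : P1) (a : stalk x) (m : F.sheaf.Germ x), m ∉ G.germs x → a • m ∈ G.germs x → a • m = 0

/-- The complement of a subsheaf that splits off. -/
def compl (G : CohSub F) (hG : G.IsSplit) : CohSub F :=
  ofGerms F
    (fun x =>
      { carrier := {m | m ∈ G.germs x → m = 0}
        smul_mem' := fun a m hm h => by
          by_cases hm' : m ∈ G.germs x
          · rw [hm hm', smul_zero]
          · exact hG x a m hm' h })
    (fun x _ => rfl)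
    -- If the generic germ of `m` lies in `G`, some nonzero multiple `s • m` lies in the stalk of
    -- `G` at `x`. If `m` is not itself in `G`, that multiple is zero by splitting, and since `s` is
    -- invertible at `η` the generic germ vanishes.
    (fun x m hm h => by
      obtain ⟨s, hs, h₁⟩ := G.exists_smul_mem x m h
      by_cases hm' : m ∈ G.germs x
      · rw [hm hm', F.gen_zero]
      · have h₂ := hG x s m hm' h₁
        have h₃ := F.sheaf.gen_smul x s m
        rw [h₂, F.gen_zero] at h₃
        exact eq_zero_of_inclusion_smul hs h₃.symm)
    (fun x => by
      classical
      obtain ⟨S, hS⟩ := F.coherent.finGen x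
      -- An element outside `G` can only be a multiple of a generator outside `G`; the base point is
      -- added as a generator for itself.
      refine ⟨insert 0 (S.filter fun g => g ∉ G.germs x), fun g hg h => ?_, fun m hm => ?_⟩
      · rcases Finset.mem_insert.1 hg with hg | hg
        · exact hg
        · exact absurd h (Finset.mem_filter.1 hg).2
      · by_cases hm' : m ∈ G.germs x
        · exact ⟨0, 0, Finset.mem_insert_self _ _, by rw [hm hm', smul_zero]⟩
        · obtain ⟨a, g, hg, rfl⟩ := hS m
          refine ⟨a, g, Finset.mem_insert_of_mem (Finset.mem_filter.2 ⟨hg, fun h => ?_⟩), rfl⟩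
          exact hm' ((G.germs x).smul_mem a h))
    (fun x n hn => by
      have hone : (1 : stalk x) ≠ 0 := fun h => one_ne_zero (α := Laurent) (congrArg Subtype.val h)
      by_cases hn' : n ∈ G.germs P1.eta
      · refine ⟨0, fun _ => rfl, 1, hone, ?_⟩
        rw [hn hn', smul_zero, F.gen_zero]
      · obtain ⟨m, s, hs, h⟩ := (F.coherent.loc x).surj n
        -- The numerator `m` stays outside `G`: otherwise `s • n` would be in `G` with `n` outside,
        -- hence zero by splitting, and then `n = 0` would be in `G`.
        refine ⟨m, fun hm => ?_, s, hs, h⟩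
        have h₁ := G.gen_mem x m hm
        rw [← h] at h₁
        have h₂ := eq_zero_of_inclusion_smul hs (hG P1.eta _ n hn' h₁)
        exact absurd (h₂ ▸ G.zero_mem_germs P1.eta) hn')

theorem mem_compl {G : CohSub F} (hG : G.IsSplit) {x : P1} {m : F.sheaf.Germ x} :
    m ∈ (G.compl hG).germs x ↔ (m ∈ G.germs x → m = 0) := mem_germs_ofGerms

theorem compl_isSplit {G : CohSub F} (hG : G.IsSplit) : (G.compl hG).IsSplit := by
  intro x a m hm ham
  rw [mem_compl] at hm ham
  by_cases h : m ∈ G.germs x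
  · exact ham ((G.germs x).smul_mem a h)
  · exact absurd (fun h' => absurd h' h) hm

/-- Membership in the complement means lying outside `G` or being the base point, and `G` contains
the base point; so complementing twice gives back `G`. -/
theorem compl_compl {G : CohSub F} (hG : G.IsSplit) :
    (G.compl hG).compl (compl_isSplit hG) = G := by
  refine ext_germs fun x m => ?_
  rw [mem_compl, mem_compl]
  by_cases h : m ∈ G.germs x
  · simp only [h, forall_const, imp_self]
  · simp only [h, false_imp_iff, forall_const, iff_false]
    rintro rfl
    exact h (G.zero_mem_germs x)

theorem compl_inj {G H : CohSub F} (hG : G.IsSplit) (hH : H.IsSplit)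
    (h : G.compl hG = H.compl hH) : G = H := by
  rw [← compl_compl hG, ← compl_compl hH]
  congr 1

/-- The complement of `G` is isomorphic to the quotient by `G`. -/
noncomputable def complIso (G : CohSub F) (hG : G.IsSplit) :
    DataIso (G.compl hG).toNormalCoh.germData G.quotData :=
  DataIso.ofBijective (D := (G.compl hG).toNormalCoh.germData) (D' := G.quotData)
    (fun x (m : (G.compl hG).germs x) => QuotMod.mk (G.germs x) m.1)
    (fun x => ⟨fun m m' h => Subtype.ext (by
        rcases QuotMod.mk_eq.1 h with h | h
        · exact h
        · exact ((mem_compl hG).1 m.2 h.1).trans ((mem_compl hG).1 m'.2 h.2).symm), fun q => by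
      obtain ⟨m, rfl⟩ := QuotMod.mk_surj q
      by_cases hm : m ∈ G.germs x
      · refine ⟨⟨0, (G.compl hG).zero_mem_germs x⟩, ?_⟩
        exact QuotMod.mk_eq.2 (Or.inr ⟨G.zero_mem_germs x, hm⟩)
      · exact ⟨⟨m, (mem_compl hG).2 fun h => absurd h hm⟩, rfl⟩⟩)
    (fun x a m => rfl) (fun x m => rfl)

theorem isoClass_compl {G : CohSub F} (hG : G.IsSplit) :
    isoClass (G.compl hG).toNormalCoh = isoClass G.quotient :=
  (isoClass_glued_eq_iff.2 ⟨(G.complIso hG).symm⟩).symm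

/-- Together with `isoClass_compl` this shows that passing to the complement interchanges the roles
of subsheaf and quotient. -/
theorem isoClass_quotient_compl {G : CohSub F} (hG : G.IsSplit) :
    isoClass (G.compl hG).quotient = isoClass G.toNormalCoh := by
  rw [← isoClass_compl (compl_isSplit hG), compl_compl]

/-- There are only finitely many subsheaves that split off. -/
theorem finite_isSplit (F : NormalCoh) : {G : CohSub F | G.IsSplit}.Finite := by
  classical
  choose S hS using F.coherent.finGen
  let T : CohSub F → Set (F.sheaf.Germ P1.origin) × Set (F.sheaf.Germ P1.infty) ×
      Set (F.sheaf.Germ P1.eta) := fun G => ({g | g ∈ S _ ∧ g ∈ G.germs _},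
    {g | g ∈ S _ ∧ g ∈ G.germs _}, {g | g ∈ S _ ∧ g ∈ G.germs _})
  -- A nonzero element of a split `G` is a multiple of a chosen generator, which must itself be in
  -- `G`. Hence a split subsheaf is recovered from the finite sets of generators that it contains,
  -- recorded by `T`.
  have key : ∀ (G H : CohSub F), G.IsSplit → ∀ x,
      {g | g ∈ S x ∧ g ∈ G.germs x} = {g | g ∈ S x ∧ g ∈ H.germs x} →
      ∀ m, m ∈ G.germs x → m ∈ H.germs x := by
    intro G H hG x h m hm
    obtain ⟨a, g, hg, rfl⟩ := hS x m
    by_cases hgG : g ∈ G.germs x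
    · exact (H.germs x).smul_mem a (h.subset ⟨hg, hgG⟩ : g ∈ S x ∧ g ∈ H.germs x).2
    · rw [hG x a g hgG hm]
      exact H.zero_mem_germs x
  refine Set.Finite.of_finite_image (f := T) ?_ ?_
  · refine Set.Finite.subset ((S _).finite_toSet.powerset.prod
      ((S _).finite_toSet.powerset.prod (S _).finite_toSet.powerset)) ?_
    rintro _ ⟨G, -, rfl⟩
    exact ⟨fun g hg => hg.1, fun g hg => hg.1, fun g hg => hg.1⟩
  · intro G hG H hH h
    refine ext_germs fun x m => ?_
    have h₁ : {g | g ∈ S x ∧ g ∈ G.germs x} = {g | g ∈ S x ∧ g ∈ H.germs x} := by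
      cases x
      · exact congrArg Prod.fst h
      · exact congrArg (fun p => p.2.1) h
      · exact congrArg (fun p => p.2.2) h
    exact ⟨key G H hG x h₁ m, key H G hH x h₁.symm m⟩

/-- A sheaf with a subsheaf that splits off is determined by the subsheaf and the quotient. -/
theorem nonempty_dataIso_of_isSplit {G : CohSub F} {G' : CohSub F'} (hG : G.IsSplit)
    (hG' : G'.IsSplit) (i : DataIso G.toNormalCoh.germData G'.toNormalCoh.germData)
    (j : DataIso G.quotData G'.quotData) : Nonempty (DataIso F.germData F'.germData) := by
  classical
  let k : DataIso (G.compl hG).toNormalCoh.germData (G'.compl hG').toNormalCoh.germData :=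
    (G.complIso hG).trans (j.trans (G'.complIso hG').symm)
  -- `F` is the wedge of `G` and its complement, so the isomorphism is defined separately on the two
  -- pieces; `hf₂` checks that the definitions agree at the common base point.
  let f : ∀ x, F.sheaf.Germ x → F'.sheaf.Germ x := fun x m =>
    if h : m ∈ G.germs x then (i.e x ⟨m, h⟩).1
    else (k.e x ⟨m, (mem_compl hG).2 fun h' => absurd h' h⟩).1
  have hf₁ : ∀ x m (h : m ∈ G.germs x), f x m = (i.e x ⟨m, h⟩).1 := fun x m h => dif_pos h
  have hf₂ : ∀ x m (h : m ∈ (G.compl hG).germs x), f x m = (k.e x ⟨m, h⟩).1 := by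
    intro x m h
    by_cases hm : m ∈ G.germs x
    · obtain rfl := (mem_compl _).1 h hm
      rw [hf₁ x 0 hm]
      exact (congrArg Subtype.val (i.map_zero x)).trans (congrArg Subtype.val (k.map_zero x)).symm
    · exact dif_neg hm
  have hor : ∀ x m, m ∈ G.germs x ∨ m ∈ (G.compl hG).germs x := fun x m => by
    by_cases hm : m ∈ G.germs x
    · exact Or.inl hm
    · exact Or.inr ((mem_compl _).2 fun h => absurd h hm)
  -- The images of the two pieces meet only in the base point, so an element of `G` and one of the
  -- complement can have the same image only if both are zero.
  have hcross : ∀ x m m', m ∈ G.germs x → m' ∈ (G.compl hG).germs x → f x m = f x m' →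
      m = m' := by
    intro x m m' hm hm' h
    rw [hf₁ x m hm, hf₂ x m' hm'] at h
    have h₀ : (i.e x ⟨m, hm⟩).1 = 0 :=
      (mem_compl hG').1 (h ▸ (k.e x ⟨m', hm'⟩).2) (i.e x ⟨m, hm⟩).2
    have h₁ : (⟨m, hm⟩ : G.germs x) = ⟨0, G.zero_mem_germs x⟩ :=
      i.map_eq_zero.1 (Subtype.ext h₀)
    have h₂ : (⟨m', hm'⟩ : (G.compl hG).germs x) = ⟨0, (G.compl hG).zero_mem_germs x⟩ :=
      k.map_eq_zero.1 (Subtype.ext (h ▸ h₀))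
    exact (congrArg Subtype.val h₁).trans (congrArg Subtype.val h₂).symm
  refine ⟨DataIso.ofBijective (D := F.germData) (D' := F'.germData) f (fun x => ⟨?_, ?_⟩) ?_ ?_⟩
  · intro m m' h
    rcases hor x m with hm | hm <;> rcases hor x m' with hm' | hm'
    · rw [hf₁ x m hm, hf₁ x m' hm'] at h
      exact congrArg Subtype.val ((i.e x).injective (Subtype.ext h))
    · exact hcross x m m' hm hm' h
    · exact (hcross x m' m hm' hm h.symm).symm
    · rw [hf₂ x m hm, hf₂ x m' hm'] at h
      exact congrArg Subtype.val ((k.e x).injective (Subtype.ext h))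
  · intro n
    by_cases hn : n ∈ G'.germs x
    · obtain ⟨m, hm⟩ := (i.e x).surjective ⟨n, hn⟩
      exact ⟨m.1, (hf₁ x m.1 m.2).trans (congrArg Subtype.val hm)⟩
    · obtain ⟨m, hm⟩ := (k.e x).surjective ⟨n, (mem_compl hG').2 fun h => absurd h hn⟩
      exact ⟨m.1, (hf₂ x m.1 m.2).trans (congrArg Subtype.val hm)⟩
  · intro x a m
    rcases hor x m with hm | hm
    · refine (hf₁ x _ ((G.germs x).smul_mem a hm)).trans ?_
      rw [hf₁ x m hm]
      exact congrArg Subtype.val (i.map_smul x a ⟨m, hm⟩)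
    · refine (hf₂ x _ (((G.compl hG).germs x).smul_mem a hm)).trans ?_
      rw [hf₂ x m hm]
      exact congrArg Subtype.val (k.map_smul x a ⟨m, hm⟩)
  · intro x m
    rcases hor x m with hm | hm
    · refine Eq.trans ?_ (hf₁ _ _ (G.gen_mem x m hm)).symm
      rw [hf₁ x m hm]
      exact congrArg Subtype.val (i.map_ρ x ⟨m, hm⟩)
    · refine Eq.trans ?_ (hf₂ _ _ ((G.compl hG).gen_mem x m hm)).symm
      rw [hf₂ x m hm]
      exact congrArg Subtype.val (k.map_ρ x ⟨m, hm⟩)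

/-! ### Transport of subsheaves along isomorphisms -/

/-- The inverse image of a subsheaf under an isomorphism. -/
def subComap (e : ModSheaf.Iso F.sheaf F'.sheaf) (G : CohSub F') : SubModSheaf F.sheaf where
  sec U :=
    { carrier := {s | e.toEquiv U s ∈ G.sub.sec U}
      smul_mem' := fun a s hs => by
        change e.toEquiv U (a • s) ∈ G.sub.sec U
        rw [e.map_smul]
        exact (G.sub.sec U).smul_mem a hs }
  zero_mem U := by
    change e.toEquiv U 0 ∈ G.sub.sec U
    have h := e.map_smul U 0 0
    rw [zero_smul, zero_smul] at h
    rw [h]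
    exact G.sub.zero_mem U
  res_mem h s hs := by
    change e.toEquiv _ _ ∈ G.sub.sec _
    rw [e.map_res]
    exact G.sub.res_mem h hs
  local_mem W s hs := G.sub.local_mem W _ fun i => by
    rw [← e.map_res]
    exact hs i

/-- A subsheaf is isomorphic to its inverse image. -/
def comapIso (e : ModSheaf.Iso F.sheaf F'.sheaf) (G : CohSub F') :
    ModSheaf.Iso G.sub.toModSheaf (subComap e G).toModSheaf where
  toEquiv U :=
    { toFun := fun s => ⟨(e.toEquiv U).symm s.1, by
        change e.toEquiv U ((e.toEquiv U).symm s.1) ∈ G.sub.sec U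
        rw [Equiv.apply_symm_apply]
        exact s.2⟩
      invFun := fun s => ⟨e.toEquiv U s.1, s.2⟩
      left_inv := fun s => Subtype.ext ((e.toEquiv U).apply_symm_apply _)
      right_inv := fun s => Subtype.ext ((e.toEquiv U).symm_apply_apply _) }
  map_smul U a s := Subtype.ext (by
    change (e.toEquiv U).symm (a • s.1) = a • (e.toEquiv U).symm s.1
    rw [Equiv.symm_apply_eq, e.map_smul, Equiv.apply_symm_apply])
  map_res {U V} h s := Subtype.ext (by
    change (e.toEquiv U).symm (F'.sheaf.res h s.1) = F.sheaf.res h ((e.toEquiv V).symm s.1)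
    rw [Equiv.symm_apply_eq, e.map_res, Equiv.apply_symm_apply])

/-- The inverse image of a coherent subsheaf under an isomorphism. -/
def comap (e : ModSheaf.Iso F.sheaf F'.sheaf) (G : CohSub F') : CohSub F where
  sub := subComap e G
  coherent := (comapIso e G).isCoherent G.coherent

theorem isoClass_comap (e : ModSheaf.Iso F.sheaf F'.sheaf) (G : CohSub F') :
    isoClass (comap e G).toNormalCoh = isoClass G.toNormalCoh :=
  (Quotient.sound (a := G.toNormalCoh) (b := (comap e G).toNormalCoh) ⟨comapIso e G⟩ :
    isoClass G.toNormalCoh = _).symm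

theorem isoClass_quotient_comap (e : ModSheaf.Iso F.sheaf F'.sheaf) (G : CohSub F') :
    isoClass (comap e G).quotient = isoClass G.quotient := by
  refine isoClass_glued_eq_glued_iff.2 ⟨DataIso.ofBijective (D := (comap e G).quotData)
    (D' := G.quotData) (fun x => QuotMod.map ((comap e G).germs x) (G.germs x)
      (e.toEquiv (nbhd x)) fun m hm => hm) (fun x => ⟨?_, ?_⟩) ?_ ?_⟩
  · intro q q' h
    obtain ⟨m, rfl⟩ := QuotMod.mk_surj q
    obtain ⟨m', rfl⟩ := QuotMod.mk_surj q'
    rcases QuotMod.mk_eq.1 h with h | h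
    · exact congrArg _ ((e.toEquiv (nbhd x)).injective h)
    · exact QuotMod.mk_eq.2 (Or.inr h)
  · intro q
    obtain ⟨m, rfl⟩ := QuotMod.mk_surj q
    exact ⟨QuotMod.mk _ ((e.toEquiv (nbhd x)).symm m),
      congrArg (QuotMod.mk _) ((e.toEquiv (nbhd x)).apply_symm_apply m)⟩
  · intro x a q
    obtain ⟨m, rfl⟩ := QuotMod.mk_surj q
    exact congrArg (QuotMod.mk (G.germs x)) (e.map_smul (nbhd x) (Reg.const x a) m)
  · intro x q
    obtain ⟨m, rfl⟩ := QuotMod.mk_surj q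
    exact congrArg (QuotMod.mk (G.germs P1.eta)) (e.map_res (eta_nbhd_le x) m).symm

theorem comap_injective (e : ModSheaf.Iso F.sheaf F'.sheaf) :
    Function.Injective (comap e : CohSub F' → CohSub F) := by
  intro G G' h
  refine ext_germs fun x m => ?_
  have key : ∀ G : CohSub F', m ∈ G.germs x ↔
      (e.toEquiv (nbhd x)).symm m ∈ (comap e G).germs x := by
    intro G
    change _ ↔ e.toEquiv (nbhd x) ((e.toEquiv (nbhd x)).symm m) ∈ G.sub.sec (nbhd x)
    exact iff_of_eq (congrArg (· ∈ G.sub.sec (nbhd x))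
      ((e.toEquiv (nbhd x)).apply_symm_apply m).symm)
  rw [key, key, h]

end CohSub

/-! ### Hall numbers -/

/-- The coherent subsheaves of `F` isomorphic to `B` with quotient isomorphic to `A`. -/
def hallSet (A B F : NormalCoh) : Set (CohSub F) :=
  {G | isoClass G.quotient = isoClass A ∧ isoClass G.toNormalCoh = isoClass B}

/-- Inverse image along an isomorphism embeds one set of subsheaves into the other. Applied in both
directions, it shows that the count depends only on the isomorphism class. Finiteness is needed
because `ncard` of an infinite set is `0`. -/
theorem hallSet_ncard_le {A B F F' : NormalCoh} (h : isoClass F = isoClass F')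
    (hfin : (hallSet A B F).Finite) : (hallSet A B F').ncard ≤ (hallSet A B F).ncard := by
  obtain ⟨e⟩ := Quotient.exact h
  refine Set.ncard_le_ncard_of_injOn (CohSub.comap e) (fun G hG => ?_)
    (CohSub.comap_injective e).injOn hfin
  exact ⟨(CohSub.isoClass_quotient_comap e G).trans hG.1, (CohSub.isoClass_comap e G).trans hG.2⟩

/-- This turns the convolution of two delta functions into the counting of subsheaves. -/
theorem delta_apply_mul (A B : NormalCoh) (F : NormalCoh) (G : CohSub F) :
    delta A (isoClass G.quotient) * delta B (isoClass G.toNormalCoh) =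
      (hallSet A B F).indicator (fun _ => (1 : ℂ)) G := by
  classical
  rw [delta, delta, Finsupp.single_apply, Finsupp.single_apply, Set.indicator_apply]
  simp only [hallSet, Set.mem_ofPred_eq, eq_comm (a := isoClass A), eq_comm (a := isoClass B)]
  split_ifs <;> simp_all

/-- The product of two delta functions exists, and its values count subsheaves, provided that the
sets to be counted are finite and that only finitely many of them are nonempty. -/
theorem exists_isHallProduct (A B : NormalCoh) (hfin : ∀ F, (hallSet A B F).Finite)
    (hsupp : {c : IsoClass | ∃ F, isoClass F = c ∧ (hallSet A B F).Nonempty}.Finite) :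
    ∃ p : Hall, IsHallProduct (delta A) (delta B) p ∧
      ∀ F, p (isoClass F) = ((hallSet A B F).ncard : ℂ) := by
  have hval : ∀ F, ((hallSet A B (Quotient.out (isoClass F))).ncard : ℂ) =
      ((hallSet A B F).ncard : ℂ) := by
    intro F
    have h : isoClass (Quotient.out (isoClass F)) = isoClass F := Quotient.out_eq _
    exact congrArg _ (le_antisymm (hallSet_ncard_le h.symm (hfin _)) (hallSet_ncard_le h (hfin _)))
  -- The product is evaluated on a class through a chosen representative, and `hval` shows that the
  -- choice does not matter.
  refine ⟨Finsupp.onFinset hsupp.toFinset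
    (fun c => ((hallSet A B (Quotient.out c)).ncard : ℂ)) ?_, ⟨fun F => ?_, fun F => ?_⟩, hval⟩
  · intro c hc
    rw [Set.Finite.mem_toFinset]
    refine ⟨Quotient.out c, Quotient.out_eq c, ?_⟩
    by_contra h
    rw [Set.not_nonempty_iff_eq_empty] at h
    exact hc (by rw [h, Set.ncard_empty, Nat.cast_zero])
  · refine (hfin F).subset fun G hG => ?_
    by_contra h
    refine hG ?_
    rw [delta_apply_mul, Set.indicator_of_notMem h]
  · refine (hval F).trans ?_
    simp only [delta_apply_mul]
    rw [← finsum_mem_def, finsum_mem_eq_finite_toFinset_sum _ (hfin F), Finset.sum_const,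
      Set.ncard_eq_toFinset_card _ (hfin F), nsmul_eq_mul, mul_one]

/-- The commutator of two delta functions, in terms of numbers of subsheaves. -/
theorem isHallCommutator_delta {A B : NormalCoh} {c : Hall}
    (hfin : ∀ F, (hallSet A B F).Finite) (hfin' : ∀ F, (hallSet B A F).Finite)
    (hsupp : {c : IsoClass | ∃ F, isoClass F = c ∧ (hallSet A B F).Nonempty}.Finite)
    (hsupp' : {c : IsoClass | ∃ F, isoClass F = c ∧ (hallSet B A F).Nonempty}.Finite)
    (hc : ∀ F, c (isoClass F) = ((hallSet A B F).ncard : ℂ) - ((hallSet B A F).ncard : ℂ)) :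
    IsHallCommutator (delta A) (delta B) c := by
  obtain ⟨p, hp, hp'⟩ := exists_isHallProduct A B hfin hsupp
  obtain ⟨q, hq, hq'⟩ := exists_isHallProduct B A hfin' hsupp'
  refine ⟨p, q, hp, hq, Finsupp.ext fun x => ?_⟩
  induction x using Quotient.inductionOn with
  | h F => exact (hc F).trans (congrArg₂ (· - ·) (hp' F).symm (hq' F).symm)

/-! ### Counting split subsheaves, and the resulting commutator criteria -/

/-- The subsheaves counted by `hallSet` that split off. -/
def splitSet (A B F : NormalCoh) : Set (CohSub F) := {G ∈ hallSet A B F | G.IsSplit}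

theorem splitSet_finite (A B F : NormalCoh) : (splitSet A B F).Finite :=
  (CohSub.finite_isSplit F).subset fun _ hG => hG.2

/-- Exchanging a subsheaf that splits off and its complement. -/
theorem splitSet_ncard_comm (A B F : NormalCoh) :
    (splitSet A B F).ncard = (splitSet B A F).ncard := by
  have hmem : ∀ {A B : NormalCoh} {G : CohSub F} (hG : G ∈ splitSet A B F),
      G.compl hG.2 ∈ splitSet B A F := fun hG =>
    ⟨⟨(CohSub.isoClass_quotient_compl hG.2).trans hG.1.2,
      (CohSub.isoClass_compl hG.2).trans hG.1.1⟩, CohSub.compl_isSplit hG.2⟩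
  exact Set.ncard_congr (fun G hG => CohSub.compl G hG.2) (fun G hG => hmem hG)
    (fun G H hG hH h => CohSub.compl_inj hG.2 hH.2 h)
    (fun G hG => ⟨G.compl hG.2, hmem hG, CohSub.compl_compl hG.2⟩)

/-- A sheaf with a split subsheaf `B` and quotient `A` is the wedge of the two, so at most one
isomorphism class occurs. -/
theorem splitSet_support_finite (A B : NormalCoh) :
    {c : IsoClass | ∃ F, isoClass F = c ∧ (splitSet A B F).Nonempty}.Finite := by
  refine Set.Subsingleton.finite ?_
  rintro _ ⟨F, rfl, G, ⟨hA, hB⟩, hG⟩ _ ⟨F', rfl, G', ⟨hA', hB'⟩, hG'⟩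
  obtain ⟨i⟩ := isoClass_eq_iff.1 (hB.trans hB'.symm)
  obtain ⟨j⟩ := isoClass_glued_eq_glued_iff.1 (hA.trans hA'.symm)
  exact isoClass_eq_iff.2 (CohSub.nonempty_dataIso_of_isSplit hG hG' i j)

/-- The commutator of two delta functions when all relevant subsheaves split off, except possibly
in the sheaves isomorphic to `E`. -/
theorem isHallCommutator_of_isSplit {A B E : NormalCoh} {c : Hall}
    (h : ∀ F, isoClass F ≠ isoClass E → ∀ G ∈ hallSet A B F, G.IsSplit)
    (h' : ∀ F, isoClass F ≠ isoClass E → ∀ G ∈ hallSet B A F, G.IsSplit)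
    (hc : ∀ F, isoClass F ≠ isoClass E → c (isoClass F) = 0)
    (hE : ∀ F, isoClass F = isoClass E → (hallSet A B F).Finite ∧ (hallSet B A F).Finite ∧
      c (isoClass F) = ((hallSet A B F).ncard : ℂ) - ((hallSet B A F).ncard : ℂ)) :
    IsHallCommutator (delta A) (delta B) c := by
  have hs : ∀ {A B : NormalCoh}, (∀ F, isoClass F ≠ isoClass E → ∀ G ∈ hallSet A B F, G.IsSplit) →
      ∀ F, isoClass F ≠ isoClass E → hallSet A B F = splitSet A B F := fun h F hF =>
    Set.ext fun G => ⟨fun hG => ⟨hG, h F hF G hG⟩, fun hG => hG.1⟩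
  have hsupp : ∀ {A B : NormalCoh},
      (∀ F, isoClass F ≠ isoClass E → ∀ G ∈ hallSet A B F, G.IsSplit) →
      {c : IsoClass | ∃ F, isoClass F = c ∧ (hallSet A B F).Nonempty}.Finite := by
    intro A B h
    -- Outside the class of `E` all counted subsheaves are split, so `E` adds at most one class to
    -- the support.
    refine ((splitSet_support_finite A B).insert (isoClass E)).subset ?_
    rintro _ ⟨F, rfl, hF⟩
    by_cases hFE : isoClass F = isoClass E
    · exact Or.inl hFE
    · exact Or.inr ⟨F, rfl, hs h F hFE ▸ hF⟩
  refine isHallCommutator_delta (fun F => ?_) (fun F => ?_) (hsupp h) (hsupp h') fun F => ?_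
  · by_cases hF : isoClass F = isoClass E
    · exact (hE F hF).1
    · exact hs h F hF ▸ splitSet_finite A B F
  · by_cases hF : isoClass F = isoClass E
    · exact (hE F hF).2.1
    · exact hs h' F hF ▸ splitSet_finite B A F
  · by_cases hF : isoClass F = isoClass E
    · exact (hE F hF).2.2
    -- Here both counts run over split subsheaves only, and taking complements cancels them.
    · rw [hs h F hF, hs h' F hF, splitSet_ncard_comm A B F, sub_self, hc F hF]

/-- If all the relevant subsheaves split off, the delta functions commute. -/
theorem isHallCommutator_zero_of_isSplit {A B : NormalCoh}
    (h : ∀ F, ∀ G ∈ hallSet A B F, G.IsSplit) (h' : ∀ F, ∀ G ∈ hallSet B A F, G.IsSplit) :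
    IsHallCommutator (delta A) (delta B) 0 := by
  have e : ∀ {A B : NormalCoh}, (∀ F, ∀ G ∈ hallSet A B F, G.IsSplit) →
      ∀ F, hallSet A B F = splitSet A B F := fun h F =>
    Set.ext fun G => ⟨fun hG => ⟨hG, h F G hG⟩, fun hG => hG.1⟩
  -- There is no exceptional sheaf in this case; `A` merely fills the place of `E`.
  refine isHallCommutator_of_isSplit (E := A) (fun F _ => h F) (fun F _ => h' F) (fun _ _ => rfl)
    fun F _ => ⟨e h F ▸ splitSet_finite A B F, e h' F ▸ splitSet_finite B A F, ?_⟩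
  rw [e h, e h', splitSet_ncard_comm A B F, sub_self]
  rfl

/-! ### Criteria for splitting -/

namespace CohSub

variable {F : NormalCoh} {G : CohSub F} {D : GluingData}

/-- A subsheaf with torsion-free quotient splits off. -/
theorem isSplit_of_torsionFree (i : DataIso G.quotData D)
    (hD : ∀ x (a : stalk x) (q : D.M x), a • q = 0 → a = 0 ∨ q = 0) : G.IsSplit := by
  intro x a m hm ham
  have h₁ : i.e x (a • QuotMod.mk (G.germs x) m) = 0 := i.map_eq_zero.2 (mk_eq_zero.2 ham)
  rcases hD x a _ ((i.map_smul x a _).symm.trans h₁) with rfl | h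
  · exact zero_smul (stalk x) m
  · exact absurd (mk_eq_zero.1 (i.map_eq_zero.1 h)) hm

/-- A divisible subsheaf splits off. -/
theorem isSplit_of_divisible (i : DataIso D G.toNormalCoh.germData)
    (hD : ∀ x (a : stalk x), a ≠ 0 → ∀ q : D.M x, ∃ q', q = a • q') : G.IsSplit := by
  intro x a m hm ham
  by_contra h0
  have ha : a ≠ 0 := by
    rintro rfl
    exact h0 (zero_smul (stalk x) m)
  obtain ⟨q, hq⟩ := (i.e x).surjective ⟨a • m, ham⟩
  obtain ⟨q', rfl⟩ := hD x a ha q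
  rw [i.map_smul] at hq
  obtain ⟨g, hg, h⟩ : ∃ g ∈ G.germs x, a • g = a • m :=
    ⟨(i.e x q').1, (i.e x q').2, congrArg Subtype.val hq⟩
  -- By divisibility the nonzero element `a • m` of `G` equals `a • g` with `g` in `G`; normality of
  -- `F` cancels `a`, so `m = g` lies in `G`.
  exact hm (F.germ_normal x a m g h0 h.symm ▸ hg)

end CohSub

/-! ### Powers of the uniformizer -/

open Classical in
/-- The `n`-th power of the uniformizer at `x`, and `1` at the other points. -/
noncomputable def mult (x : P1) (n : ℕ) (y : P1) : stalk y := if y = x then unif y ^ n else 1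

theorem mult_self (x : P1) (n : ℕ) : mult x n x = unif x ^ n := if_pos rfl

theorem mult_of_ne {x y : P1} (h : y ≠ x) (n : ℕ) : mult x n y = 1 := if_neg h

theorem mult_add (x : P1) (n k : ℕ) (y : P1) : mult x (n + k) y = mult x n y * mult x k y := by
  by_cases h : y = x
  · subst h
    simp only [mult_self, pow_add]
  · simp only [mult_of_ne h, mul_one]

theorem stalk_val_ne {x : P1} {a : stalk x} (ha : a ≠ 0) : (a : Laurent) ≠ 0 :=
  fun h => ha (Subtype.ext h)

theorem stalk_one_ne_zero (x : P1) : (1 : stalk x) ≠ 0 := fun h =>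
  one_ne_zero (α := Laurent) (congrArg Subtype.val h)

theorem stalk_mul_cancel {x : P1} {a b c : stalk x} (ha : a ≠ 0) (h : a * b = a * c) : b = c :=
  Subtype.ext (mul_left_cancel₀ (stalk_val_ne ha) (congrArg Subtype.val h))

theorem unif_pow_ne_zero (x : P1) (n : ℕ) : unif x ^ n ≠ 0 := fun h =>
  pow_ne_zero n (unif_ne x) (congrArg Subtype.val h)

theorem mult_ne_zero (x : P1) (n : ℕ) (y : P1) : mult x n y ≠ 0 := by
  by_cases h : y = x
  · subst h
    rw [mult_self]
    exact unif_pow_ne_zero y n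
  · rw [mult_of_ne h]
    exact stalk_one_ne_zero y

theorem mult_eta (x : P1) (n : ℕ) : mult x n P1.eta = 1 := by
  by_cases h : P1.eta = x
  · subst h
    rw [mult_self]
    exact one_pow n
  · exact mult_of_ne h n

/-- With `mult`, the ideals at all three points are principal, generated by `mult x n y`, and case
distinctions on the point disappear from later statements. -/
theorem mem_pointIdeal {x : P1} {n : ℕ} {y : P1} {a : stalk y} :
    a ∈ pointIdeal x n y ↔ mult x n y ∣ a := by
  by_cases h : y = x
  · subst h
    rw [mult_self]
    exact ⟨fun h => h rfl, fun h _ => h⟩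
  · rw [mult_of_ne h]
    exact ⟨fun _ => one_dvd a, fun _ h' => absurd h' h⟩

theorem not_unif_pow_succ_dvd {x : P1} (hx : x ≠ P1.eta) (n : ℕ) :
    ¬ unif x ^ (n + 1) ∣ unif x ^ n := by
  rintro ⟨b, hb⟩
  refine unif_not_isUnit hx (IsUnit.of_mul_eq_one b ?_)
  refine stalk_mul_cancel (unif_pow_ne_zero x n) ?_
  rw [← mul_assoc, ← pow_succ, ← hb, mul_one]

/-- In a normal module over the stalk at `x`, an element killed by a power of the uniformizer has
pairwise distinct nonzero multiples. -/
theorem eq_of_smul_eq_smul {M : Type} {x : P1} [Zero M] [MulActionWithZero (stalk x) M]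
    (hM : NormalModule (stalk x) M) (hx : x ≠ P1.eta) {h : M} {n : ℕ} (hn : unif x ^ n • h = 0)
    {a b : stalk x} (hab : a • h = b • h) (h0 : a • h ≠ 0) : a = b := by
  -- Normality cancels `uⁱ`, leaving `h = uʲ • h`. Iterating `n` times gives `h = uʲⁿ • h`, which is
  -- zero for `j > 0` because then `jn ≥ n`; this contradicts `uⁱ • h ≠ 0`.
  have key : ∀ i j : ℕ, unif x ^ i • h = unif x ^ (i + j) • h → unif x ^ i • h ≠ 0 → j = 0 := by
    intro i j hij h0
    by_contra hj
    rw [pow_add, mul_smul] at hij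
    have h₁ : h = unif x ^ j • h := hM _ _ _ h0 hij
    have h₂ : ∀ k : ℕ, h = (unif x ^ j) ^ k • h := by
      intro k
      induction k with
      | zero => rw [pow_zero, one_smul]
      | succ k ih => rw [pow_succ, mul_smul, ← h₁, ← ih]
    have h₃ := h₂ n
    obtain ⟨l, hl⟩ : ∃ l, j * n = l + n := ⟨j * n - n, by
      have := Nat.le_mul_of_pos_left n (Nat.pos_of_ne_zero hj)
      omega⟩
    rw [← pow_mul, hl, pow_add, mul_smul, hn, smul_zero] at h₃
    rw [h₃, smul_zero] at h0
    exact h0 rfl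
  have ha : a ≠ 0 := by
    rintro rfl
    exact h0 (zero_smul _ h)
  have hb : b ≠ 0 := by
    rintro rfl
    rw [hab] at h0
    exact h0 (zero_smul _ h)
  obtain ⟨i, rfl⟩ := eq_unif_pow hx ha
  obtain ⟨j, rfl⟩ := eq_unif_pow hx hb
  rcases le_total i j with hij | hij
  · obtain ⟨k, rfl⟩ := Nat.exists_eq_add_of_le hij
    rw [key i k hab h0, add_zero]
  · obtain ⟨k, rfl⟩ := Nat.exists_eq_add_of_le hij
    rw [hab] at h0
    rw [key j k hab.symm h0, add_zero]

/-! ### Characterization of torsion sheaves -/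

/-- The elements `h y` generate the stalks, and their annihilators are those of the generators
of `𝒯_{x,n}`. -/
structure TorsionGen (D : GluingData) (x : P1) (n : ℕ) (h : ∀ y, D.M y) : Prop where
  gen : ∀ y (m : D.M y), ∃ a : stalk y, m = a • h y
  ann : ∀ y (a : stalk y), a • h y = 0 ↔ mult x n y ∣ a

namespace TorsionGen

variable {D : GluingData} {x : P1} {n : ℕ} {h : ∀ y, D.M y}

theorem eq_zero (H : TorsionGen D x n h) {y : P1} (hy : y ≠ x) (m : D.M y) : m = 0 := by
  obtain ⟨a, rfl⟩ := H.gen y m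
  rw [H.ann, mult_of_ne hy]
  exact one_dvd a

/-- Away from `x` the stalks are zero; at `x` the generator is killed by `uⁿ`, so by normality its
nonzero multiples are pairwise distinct. -/
theorem eq_or (H : TorsionGen D x n h) (hx : x ≠ P1.eta) {y : P1} {a b : stalk y}
    (hab : a • h y = b • h y) : a = b ∨ (a • h y = 0 ∧ b • h y = 0) := by
  by_cases h0 : a • h y = 0
  · exact Or.inr ⟨h0, hab ▸ h0⟩
  · by_cases hy : y = x
    · subst hy
      have hn : unif y ^ n • h y = 0 := by
        rw [H.ann, mult_self]
      exact Or.inl (eq_of_smul_eq_smul (D.normal y) hx hn hab h0)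
    · exact absurd (H.eq_zero hy _) h0

theorem ne_zero (H : TorsionGen D x n h) (hx : x ≠ P1.eta) (hn : 0 < n) : h x ≠ 0 := by
  intro h0
  have h₁ : (1 : stalk x) • h x = 0 := by rw [h0, smul_zero]
  rw [H.ann, mult_self] at h₁
  refine not_unif_pow_succ_dvd hx 0 ?_
  rw [pow_zero, zero_add]
  exact (pow_dvd_pow _ hn).trans h₁

end TorsionGen

theorem TorsionGen.map {D D' : GluingData} {x : P1} {n : ℕ} {h : ∀ y, D.M y}
    (H : TorsionGen D x n h) (j : DataIso D D') : TorsionGen D' x n (fun y => j.e y (h y)) where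
  gen y m := by
    obtain ⟨a, ha⟩ := H.gen y ((j.e y).symm m)
    exact ⟨a, by rw [← j.map_smul, ← ha, Equiv.apply_symm_apply]⟩
  ann y a := by rw [← j.map_smul, j.map_eq_zero, H.ann]

theorem torsionGen_torsionData (x : P1) (n : ℕ+) :
    TorsionGen (torsionData x n) x n (fun y => QuotMod.mk (pointIdeal x n y) 1) where
  gen y m := by
    obtain ⟨a, rfl⟩ := QuotMod.mk_surj m
    exact ⟨a, congrArg (QuotMod.mk (pointIdeal x n y)) (mul_one a).symm⟩
  ann y a := by
    rw [← mem_pointIdeal]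
    refine (QuotMod.mk_eq (N := pointIdeal x n y) (m := a • 1) (m' := 0)).trans ?_
    rw [smul_eq_mul, mul_one]
    constructor
    · rintro (rfl | h)
      · exact zero_mem_pointIdeal x n y
      · exact h.1
    · exact fun h => Or.inr ⟨h, zero_mem_pointIdeal x n y⟩

/-- The map `a ↦ a • h y` factors through the quotient by `pointIdeal` because of the annihilator
condition. Over a monoid the annihilator alone does not determine a cyclic module; injectivity comes
from `TorsionGen.eq_or`, hence from normality. -/
theorem nonempty_iso_torsionData {D : GluingData} {x : P1} (hx : x ≠ P1.eta) {n : ℕ+} :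
    Nonempty (DataIso D (torsionData x n)) ↔ ∃ h, TorsionGen D x n h := by
  constructor
  · rintro ⟨i⟩
    exact ⟨_, (torsionGen_torsionData x n).map i.symm⟩
  · rintro ⟨h, H⟩
    refine ⟨DataIso.symm (DataIso.ofBijective (D := torsionData x n) (D' := D)
      (fun y => Quotient.lift (s := collapse (pointIdeal x n y)) (fun a : stalk y => a • h y) ?_)
      (fun y => ⟨?_, ?_⟩) ?_ ?_)⟩
    · rintro a b (rfl | ⟨ha, hb⟩)
      · rfl
      · exact ((H.ann y a).2 (mem_pointIdeal.1 ha)).trans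
          ((H.ann y b).2 (mem_pointIdeal.1 hb)).symm
    · intro q q' hq
      obtain ⟨a, rfl⟩ := QuotMod.mk_surj q
      obtain ⟨b, rfl⟩ := QuotMod.mk_surj q'
      rcases H.eq_or hx hq with rfl | ⟨ha, hb⟩
      · rfl
      · exact QuotMod.mk_eq.2 (Or.inr ⟨mem_pointIdeal.2 ((H.ann y a).1 ha),
          mem_pointIdeal.2 ((H.ann y b).1 hb)⟩)
    · intro m
      obtain ⟨a, rfl⟩ := H.gen y m
      exact ⟨QuotMod.mk _ a, rfl⟩
    · intro y a q
      obtain ⟨b, rfl⟩ := QuotMod.mk_surj q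
      exact mul_smul a b (h y)
    · intro y q
      exact (H.eq_zero hx.symm _).trans (H.eq_zero hx.symm _).symm

/-! ### Characterization of line bundles -/

/-- The element `tᵏ` of the generic stalk. -/
def etaPow (k : ℤ) : stalk P1.eta := ⟨tpow k, trivial⟩

theorem etaPow_add (k l : ℤ) : etaPow (k + l) = etaPow k * etaPow l :=
  Subtype.ext (WithZero.exp_add k l)

theorem etaPow_zero : etaPow 0 = 1 := Subtype.ext WithZero.exp_zero

theorem etaPow_ne_zero (k : ℤ) : etaPow k ≠ 0 := fun h =>
  WithZero.exp_ne_zero (congrArg Subtype.val h)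

theorem etaPow_smul_smul {M : Type} [Zero M] [MulActionWithZero (stalk P1.eta) M] (k l : ℤ)
    (m : M) : etaPow k • etaPow l • m = etaPow (k + l) • m := by
  rw [etaPow_add, mul_smul]

theorem eq_etaPow_neg_smul {M : Type} [Zero M] [MulActionWithZero (stalk P1.eta) M] {k : ℤ}
    {m m' : M} (h : etaPow k • m = m') : m = etaPow (-k) • m' := by
  rw [← h, etaPow_smul_smul, neg_add_cancel, etaPow_zero, one_smul]

theorem stalk_eta_mul_cancel {a b c : stalk P1.eta} (hc : c ≠ 0) (h : a * c = b * c) : a = b :=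
  stalk_mul_cancel hc (by rw [mul_comm c a, mul_comm c b, h])

/-- The elements `h y` freely generate the stalks, and at the generic point `h y` differs from
`h η` by the factor `t ^ i y`. -/
structure LineGen (D : GluingData) (h : ∀ y, D.M y) (i : P1 → ℤ) : Prop where
  gen : ∀ y (m : D.M y), ∃ a : stalk y, m = a • h y
  inj : ∀ a b : stalk P1.eta, a • h P1.eta = b • h P1.eta → a = b
  map_ρ : ∀ y, D.ρ y (h y) = etaPow (i y) • h P1.eta

/-- Freeness is required at `η` only: there `h y` becomes a unit times `h η`, and the stalk at `y`
embeds in the generic one. -/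
theorem LineGen.inj_at {D : GluingData} {h : ∀ y, D.M y} {i : P1 → ℤ} (H : LineGen D h i) {y : P1}
    {a b : stalk y} (hab : a • h y = b • h y) : a = b := by
  have h₁ := congrArg (D.ρ y) hab
  rw [D.ρ_smul, D.ρ_smul, H.map_ρ, ← mul_smul, ← mul_smul] at h₁
  have h₂ := stalk_eta_mul_cancel (etaPow_ne_zero _) (H.inj _ _ h₁)
  exact Subtype.ext (congrArg (Subtype.val : stalk P1.eta → Laurent) h₂)

theorem LineGen.torsionFree {D : GluingData} {h : ∀ y, D.M y} {i : P1 → ℤ} (H : LineGen D h i)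
    {y : P1} {a : stalk y} {m : D.M y} (ham : a • m = 0) : a = 0 ∨ m = 0 := by
  obtain ⟨b, rfl⟩ := H.gen y m
  by_cases ha : a = 0
  · exact Or.inl ha
  · right
    rw [← mul_smul, ← zero_smul (stalk y) (h y)] at ham
    have h₁ := H.inj_at ham
    rw [← mul_zero a] at h₁
    rw [stalk_mul_cancel ha h₁, zero_smul]

/-- The transition factors of `𝒪(m)`. -/
def lineDeg (m : ℤ) : P1 → ℤ
  | .origin => -m
  | .infty => 0
  | .eta => 0

theorem lineData_ρ (m : ℤ) (y : P1) (a : stalk y) :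
    (lineData m).ρ y a = Submonoid.inclusion (stalk_le_eta y) a * etaPow (lineDeg m y) := by
  cases y with
  | origin => rfl
  | infty =>
    change Submonoid.inclusion (stalk_le_eta .infty) a =
      Submonoid.inclusion (stalk_le_eta .infty) a * etaPow 0
    rw [etaPow_zero, mul_one]
  | eta =>
    change a = a * etaPow 0
    rw [etaPow_zero, mul_one]

theorem lineGen_lineData (m : ℤ) : LineGen (lineData m) (fun y => (1 : stalk y)) (lineDeg m) where
  gen y (a : stalk y) := ⟨a, (mul_one a).symm⟩
  inj (a b : stalk P1.eta) (h : a * 1 = b * 1) := by rwa [mul_one, mul_one] at h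
  map_ρ y := by
    refine (lineData_ρ m y 1).trans ?_
    exact mul_comm (1 : stalk P1.eta) (etaPow (lineDeg m y))

theorem LineGen.map {D D' : GluingData} {h : ∀ y, D.M y} {i : P1 → ℤ} (H : LineGen D h i)
    (j : DataIso D D') : LineGen D' (fun y => j.e y (h y)) i where
  gen y m := by
    obtain ⟨a, ha⟩ := H.gen y ((j.e y).symm m)
    exact ⟨a, by rw [← j.map_smul, ← ha, Equiv.apply_symm_apply]⟩
  inj a b hab := by
    rw [← j.map_smul, ← j.map_smul] at hab
    exact H.inj a b ((j.e P1.eta).injective hab)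
  map_ρ y := by rw [j.map_ρ, H.map_ρ, j.map_smul]

theorem nonempty_iso_of_lineGen {D : GluingData} {h : ∀ y, D.M y} {m : ℤ}
    (H : LineGen D h (lineDeg m)) : Nonempty (DataIso (lineData m) D) := by
  refine ⟨DataIso.ofBijective (D := lineData m) (fun y (a : stalk y) => a • h y)
    (fun y => ⟨fun a b hab => H.inj_at hab, fun r => ?_⟩) (fun y a b => mul_smul a b (h y))
    fun y (a : stalk y) => ?_⟩
  · obtain ⟨a, rfl⟩ := H.gen y r
    exact ⟨a, rfl⟩
  · refine Eq.trans ?_ (congrArg (fun b : stalk P1.eta => b • h P1.eta) (lineData_ρ m y a)).symm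
    rw [D.ρ_smul, H.map_ρ, mul_smul]

/-- Rescaling the generic generator by a power of `t` shifts the exponents at `0` and `∞` by the
same amount, so their difference is what matters; it is the degree of the line bundle. -/
theorem nonempty_iso_lineData {D : GluingData} {m : ℤ} :
    Nonempty (DataIso D (lineData m)) ↔
      ∃ h i, LineGen D h i ∧ i P1.infty - i P1.origin = m := by
  constructor
  · rintro ⟨j⟩
    exact ⟨_, _, (lineGen_lineData m).map j.symm, by simp [lineDeg]⟩
  · rintro ⟨h, i, H, hm⟩
    -- The generic generator is rescaled so that the exponent at `∞` becomes `0`, as in `lineDeg m`;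
    -- the exponent at `0` is then `-m`.
    let h' : ∀ y, D.M y := fun y => match y with
      | .origin => h .origin
      | .infty => h .infty
      | .eta => etaPow (i .infty) • h .eta
    have H' : LineGen D h' (lineDeg m) := by
      refine ⟨fun y r => ?_, fun a b hab => ?_, fun y => ?_⟩
      · obtain ⟨a, rfl⟩ := H.gen y r
        cases y with
        | origin => exact ⟨a, rfl⟩
        | infty => exact ⟨a, rfl⟩
        | eta =>
          refine ⟨a * etaPow (-i .infty), ?_⟩
          change _ = (a * etaPow (-i .infty)) • etaPow (i .infty) • h .eta
          rw [mul_smul, etaPow_smul_smul, neg_add_cancel, etaPow_zero, one_smul]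
      · change a • etaPow (i .infty) • h .eta = b • etaPow (i .infty) • h .eta at hab
        rw [← mul_smul, ← mul_smul] at hab
        exact stalk_eta_mul_cancel (etaPow_ne_zero _) (H.inj _ _ hab)
      · cases y with
        | origin =>
          refine (H.map_ρ .origin).trans ?_
          change _ = etaPow (-m) • etaPow (i .infty) • h .eta
          rw [etaPow_smul_smul]
          congr 2
          omega
        | infty =>
          refine (H.map_ρ .infty).trans ?_
          change _ = etaPow 0 • etaPow (i .infty) • h .eta
          rw [etaPow_smul_smul, zero_add]
        | eta =>
          refine (D.ρ_eta _).trans ?_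
          change _ = etaPow 0 • _
          rw [etaPow_zero, one_smul]
    obtain ⟨j⟩ := nonempty_iso_of_lineGen H'
    exact ⟨j.symm⟩

/-! ### Multiples of a sheaf by a power of the uniformizer -/

namespace CohSub

variable {F : NormalCoh}

/-- The subsheaf `uⁿ F`, where `u` is the uniformizer at `x`. -/
noncomputable def powSub (F : NormalCoh) (x : P1) (n : ℕ) : CohSub F :=
  ofGerms F
    (fun y =>
      { carrier := {m | ∃ m' : F.sheaf.Germ y, m = mult x n y • m'}
        smul_mem' := by
          rintro a _ ⟨m, rfl⟩
          exact ⟨a • m, by rw [← mul_smul, ← mul_smul, mul_comm]⟩ })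
    (fun y => ⟨0, (smul_zero _).symm⟩)
    (fun y m _ => ⟨F.sheaf.gen y m, by rw [mult_eta, one_smul]⟩)
    (fun y => by
      classical
      obtain ⟨S, hS⟩ := F.coherent.finGen y
      refine ⟨S.image fun g => mult x n y • g, fun g hg => ?_, ?_⟩
      · obtain ⟨g, -, rfl⟩ := Finset.mem_image.1 hg
        exact ⟨g, rfl⟩
      · rintro _ ⟨m, rfl⟩
        obtain ⟨a, g, hg, rfl⟩ := hS m
        exact ⟨a, _, Finset.mem_image_of_mem _ hg, by rw [← mul_smul, ← mul_smul, mul_comm]⟩)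
    (fun y k _ => by
      obtain ⟨m, s, hs, h⟩ := (F.coherent.loc y).surj k
      -- The fraction `m / s` is expanded by `mult x n y` so that its numerator lies in the
      -- subsheaf.
      refine ⟨mult x n y • m, ⟨m, rfl⟩, mult x n y * s,
        stalk_mul_ne_zero (mult_ne_zero x n y) hs, ?_⟩
      rw [F.sheaf.gen_smul, ← h, map_mul, mul_smul])

theorem mem_powSub {x : P1} {n : ℕ} {y : P1} {m : F.sheaf.Germ y} :
    m ∈ (powSub F x n).germs y ↔ ∃ m', m = mult x n y • m' := mem_germs_ofGerms

/-- If the stalks of `F` are cyclic, then `uⁿ F` is the only subsheaf with quotient `𝒯_{x,n}`. -/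
theorem eq_powSub {G : CohSub F} {x : P1} {n : ℕ} {q : ∀ y, QuotMod (G.germs y)}
    (Q : TorsionGen G.quotData x n q) {h : ∀ y, F.sheaf.Germ y}
    (gen : ∀ y (m : F.sheaf.Germ y), ∃ a : stalk y, m = a • h y) : G = powSub F x n := by
  -- The class of `h y` and the generator `q y` generate the same quotient stalk, so each is a
  -- multiple of the other and they have the same annihilator. This determines which multiples of `h
  -- y` lie in `G`.
  have key : ∀ y (a : stalk y), a • h y ∈ G.germs y ↔ mult x n y ∣ a := by
    intro y a
    have h₁ : a • h y ∈ G.germs y ↔ a • QuotMod.mk (G.germs y) (h y) = 0 := mk_eq_zero.symm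
    rw [h₁, ← Q.ann]
    obtain ⟨b, hb⟩ : ∃ b : stalk y, QuotMod.mk (G.germs y) (h y) = b • q y := Q.gen y _
    obtain ⟨r, hr⟩ := QuotMod.mk_surj (q y)
    obtain ⟨c, rfl⟩ := gen y r
    have hc : q y = c • QuotMod.mk (G.germs y) (h y) := hr.symm
    constructor
    · intro h'
      change a • q y = 0
      rw [hc, ← mul_smul, mul_comm, mul_smul, h', smul_zero]
    · intro h'
      have h'' : a • q y = 0 := h'
      rw [hb, ← mul_smul, mul_comm, mul_smul, h'', smul_zero]
  refine ext_germs fun y m => ?_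
  rw [mem_powSub]
  constructor
  · intro hm
    obtain ⟨a, rfl⟩ := gen y m
    obtain ⟨b, rfl⟩ := (key y a).1 hm
    exact ⟨b • h y, mul_smul _ _ _⟩
  · rintro ⟨m', rfl⟩
    obtain ⟨b, rfl⟩ := gen y m'
    rw [← mul_smul, key]
    exact dvd_mul_right _ _

/-- The quotient of a sheaf with cyclic stalks by `uⁿ F`. -/
theorem torsionGen_powSub {x : P1} {n : ℕ} {h : ∀ y, F.sheaf.Germ y}
    (gen : ∀ y (m : F.sheaf.Germ y), ∃ a : stalk y, m = a • h y)
    (hdvd : ∀ y (a b : stalk y), a • h y = (mult x n y * b) • h y → mult x n y ∣ a) :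
    TorsionGen (powSub F x n).quotData x n (fun y => QuotMod.mk _ (h y)) where
  gen y q := by
    obtain ⟨m, rfl⟩ := QuotMod.mk_surj q
    obtain ⟨a, rfl⟩ := gen y m
    exact ⟨a, rfl⟩
  ann y a := by
    have h₁ : a • QuotMod.mk ((powSub F x n).germs y) (h y) = 0 ↔
        a • h y ∈ (powSub F x n).germs y := mk_eq_zero
    refine h₁.trans ?_
    rw [mem_powSub]
    constructor
    · rintro ⟨m', h₂⟩
      obtain ⟨b, rfl⟩ := gen y m'
      exact hdvd y a b (h₂.trans (mul_smul _ _ _).symm)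
    · rintro ⟨b, rfl⟩
      exact ⟨b • h y, mul_smul _ _ _⟩

/-- A nonsplit extension of `𝒯_{x,n}` by a sheaf with cyclic stalks has cyclic stalks. -/
theorem exists_generators_of_not_isSplit {G : CohSub F} {x : P1} (hx : x ≠ P1.eta) {n : ℕ}
    (hn : 0 < n) {q : ∀ y, QuotMod (G.germs y)} (Q : TorsionGen G.quotData x n q)
    {g : ∀ y, F.sheaf.Germ y} (hg : ∀ y, g y ∈ G.germs y)
    (gen : ∀ y, ∀ m ∈ G.germs y, ∃ a : stalk y, m = a • g y) (hG : ¬ G.IsSplit) :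
    ∃ h : ∀ y, F.sheaf.Germ y, (∀ y (m : F.sheaf.Germ y), ∃ a : stalk y, m = a • h y) ∧
      (∀ y, g y = mult x n y • h y) ∧
      ∀ y (a : stalk y), a • h y ∈ G.germs y → mult x n y ∣ a := by
  classical
  have htop : ∀ y, y ≠ x → ∀ m : F.sheaf.Germ y, m ∈ G.germs y := fun y hy m =>
    mk_eq_zero.1 (Q.eq_zero hy (QuotMod.mk (G.germs y) m))
  obtain ⟨r, hr⟩ := QuotMod.mk_surj (q x)
  have hann : ∀ a : stalk x, a • r ∈ G.germs x ↔ unif x ^ n ∣ a := by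
    intro a
    have h₁ : a • r ∈ G.germs x ↔ a • q x = 0 := by
      rw [← hr]
      exact mk_eq_zero.symm
    rw [h₁, ← mult_self]
    exact Q.ann x a
  -- The quotient makes no identifications outside `G`, so an equality of nonzero classes is an
  -- equality in `F`: every element outside `G` is a multiple of the lift `r`.
  have hout : ∀ m : F.sheaf.Germ x, m ∉ G.germs x → ∃ a : stalk x, m = a • r := by
    intro m hm
    obtain ⟨a, ha⟩ : ∃ a : stalk x, QuotMod.mk (G.germs x) m = a • q x := Q.gen x _
    rw [← hr, QuotMod.smul_mk] at ha
    rcases QuotMod.mk_eq.1 ha with h | h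
    · exact ⟨a, h⟩
    · exact absurd h.1 hm
  -- A witness of nonsplitting lies over `x` and is a multiple of `r`, with a nonzero multiple in
  -- `G`. Hence `uⁿ • r` is nonzero, and being in `G` it is `uᵏ • g x` for some `k`. It remains to
  -- exclude `k > 0`.
  have hgr : g x = unif x ^ n • r := by
    simp only [IsSplit, not_forall] at hG
    obtain ⟨y, a, m, hm, ham, h0⟩ := hG
    obtain rfl : y = x := by
      by_contra hy
      exact hm (htop y hy m)
    obtain ⟨b, rfl⟩ := hout m hm
    rw [← mul_smul] at ham h0
    obtain ⟨c, hc⟩ := (hann _).1 ham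
    have hr0 : unif y ^ n • r ≠ 0 := by
      intro h
      rw [hc, mul_comm, mul_smul, h, smul_zero] at h0
      exact h0 rfl
    obtain ⟨d, hd⟩ := gen y _ ((hann (unif y ^ n)).2 dvd_rfl)
    have hd0 : d ≠ 0 := by
      rintro rfl
      exact hr0 (hd.trans (zero_smul _ _))
    obtain ⟨k, rfl⟩ := eq_unif_pow hx hd0
    rcases k with _ | k
    · rw [hd, pow_zero, one_smul]
    -- Both exponents are positive, so normality cancels one factor `u`. Then `uⁿ⁻¹ • r` would lie
    -- in `G`, although `uⁿ` is the least power carrying `r` into `G`.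
    · obtain ⟨l, rfl⟩ := Nat.exists_eq_add_of_lt hn
      rw [zero_add, pow_succ', mul_smul, pow_succ' (unif y) k, mul_smul] at hd
      rw [zero_add, pow_succ', mul_smul] at hr0
      have h₁ := F.germ_normal y _ _ _ hr0 hd
      have h₂ : unif y ^ l • r ∈ G.germs y := h₁ ▸ (G.germs y).smul_mem _ (hg y)
      have h₃ := (hann _).1 h₂
      rw [zero_add] at h₃
      exact absurd h₃ (not_unif_pow_succ_dvd hx l)
  -- At `x` the new generator is the lift `r`; at the other points `G` is the whole stalk and its
  -- own generator serves.
  let h : ∀ y, F.sheaf.Germ y := fun y => if hy : y = x then hy ▸ r else g y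
  have hhx : h x = r := dif_pos rfl
  have hhy : ∀ y, y ≠ x → h y = g y := fun y hy => dif_neg hy
  refine ⟨h, fun y m => ?_, fun y => ?_, fun y a ha => ?_⟩
  · by_cases hy : y = x
    · subst hy
      rw [hhx]
      by_cases hm : m ∈ G.germs y
      · obtain ⟨a, rfl⟩ := gen y m hm
        exact ⟨a * unif y ^ n, by rw [hgr, mul_smul]⟩
      · exact hout m hm
    · rw [hhy y hy]
      exact gen y m (htop y hy m)
  · by_cases hy : y = x
    · subst hy
      rw [hhx, hgr, mult_self]
    · rw [hhy y hy, mult_of_ne hy, one_smul]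
  · by_cases hy : y = x
    · subst hy
      rw [hhx] at ha
      rw [mult_self]
      exact (hann a).1 ha
    · rw [mult_of_ne hy]
      exact one_dvd a

/-- A generating family of a subsheaf, in terms of the ambient sheaf. -/
theorem torsionGen_sub_iff {G : CohSub F} {x : P1} {n : ℕ} :
    (∃ g, TorsionGen G.toNormalCoh.germData x n g) ↔
      ∃ g : ∀ y, F.sheaf.Germ y, (∀ y, g y ∈ G.germs y) ∧
        (∀ y, ∀ m ∈ G.germs y, ∃ a : stalk y, m = a • g y) ∧
        ∀ y (a : stalk y), a • g y = 0 ↔ mult x n y ∣ a := by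
  constructor
  · rintro ⟨g, H⟩
    refine ⟨fun y => (g y).1, fun y => (g y).2, fun y m hm => ?_, fun y a => ?_⟩
    · obtain ⟨a, ha⟩ := H.gen y ⟨m, hm⟩
      exact ⟨a, congrArg Subtype.val ha⟩
    · rw [← H.ann]
      exact ⟨fun h => Subtype.ext h, fun h => congrArg Subtype.val h⟩
  · rintro ⟨g, hg, gen, ann⟩
    refine ⟨fun y => ⟨g y, hg y⟩, fun y m => ?_, fun y a => ?_⟩
    · obtain ⟨a, ha⟩ := gen y m.1 m.2
      exact ⟨a, Subtype.ext ha⟩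
    · rw [← ann]
      exact ⟨fun h => congrArg Subtype.val h, fun h => Subtype.ext h⟩

theorem lineGen_sub_iff {G : CohSub F} {i : P1 → ℤ} :
    (∃ g, LineGen G.toNormalCoh.germData g i) ↔
      ∃ g : ∀ y, F.sheaf.Germ y, (∀ y, g y ∈ G.germs y) ∧
        (∀ y, ∀ m ∈ G.germs y, ∃ a : stalk y, m = a • g y) ∧
        (∀ a b : stalk P1.eta, a • g P1.eta = b • g P1.eta → a = b) ∧
        ∀ y, F.sheaf.gen y (g y) = etaPow (i y) • g P1.eta := by
  constructor
  · rintro ⟨g, H⟩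
    refine ⟨fun y => (g y).1, fun y => (g y).2, fun y m hm => ?_,
      fun a b hab => H.inj a b (Subtype.ext hab), fun y => congrArg Subtype.val (H.map_ρ y)⟩
    obtain ⟨a, ha⟩ := H.gen y ⟨m, hm⟩
    exact ⟨a, congrArg Subtype.val ha⟩
  · rintro ⟨g, hg, gen, inj, hρ⟩
    refine ⟨fun y => ⟨g y, hg y⟩, fun y m => ?_,
      fun a b hab => inj a b (congrArg Subtype.val hab), fun y => Subtype.ext (hρ y)⟩
    obtain ⟨a, ha⟩ := gen y m.1 m.2
    exact ⟨a, Subtype.ext ha⟩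

end CohSub

/-! ### Degrees -/

/-- The exponent of `t` in the uniformizer. -/
def unifDeg : P1 → ℤ
  | .origin => 1
  | .infty => -1
  | .eta => 0

theorem inclusion_unif (x : P1) :
    Submonoid.inclusion (stalk_le_eta x) (unif x) = etaPow (unifDeg x) := by
  cases x with
  | origin => rfl
  | infty => rfl
  | eta => exact etaPow_zero.symm

open Classical in
/-- The exponent of `t` in `mult x n y`. -/
noncomputable def multDeg (x : P1) (n : ℕ) (y : P1) : ℤ := if y = x then n * unifDeg x else 0

theorem inclusion_mult (x : P1) (n : ℕ) (y : P1) :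
    Submonoid.inclusion (stalk_le_eta y) (mult x n y) = etaPow (multDeg x n y) := by
  by_cases hy : y = x
  · subst hy
    rw [mult_self, multDeg, if_pos rfl, map_pow, inclusion_unif]
    refine Subtype.ext ?_
    change tpow (unifDeg y) ^ n = tpow _
    rw [← WithZero.exp_nsmul, nsmul_eq_mul]
  · rw [mult_of_ne hy, multDeg, if_neg hy, map_one, etaPow_zero]

/-- At `0` the factor `uⁿ = tⁿ` raises the exponent at `0` by `n`; at `∞` the factor `uⁿ = t⁻ⁿ`
lowers the exponent at `∞` by `n`. In both cases the degree drops by `n`, which is why relation 2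
has the same form at both points. -/
theorem multDeg_sub {x : P1} (hx : x ≠ P1.eta) (n : ℕ) :
    multDeg x n P1.infty - multDeg x n P1.origin = -n := by
  cases x with
  | origin => simp [multDeg, unifDeg]
  | infty => simp [multDeg, unifDeg]
  | eta => exact absurd rfl hx

/-! ### Extensions of torsion sheaves -/

namespace CohSub

variable {F : NormalCoh} {x : P1}

/-- A nonsplit extension of `𝒯_{x,n}` by `𝒯_{x,k}` is `𝒯_{x,n+k}`. -/
theorem torsionGen_of_not_isSplit (hx : x ≠ P1.eta) {n k : ℕ} (hn : 0 < n) {G : CohSub F}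
    (hQ : ∃ q, TorsionGen G.quotData x n q) (hg : ∃ g, TorsionGen G.toNormalCoh.germData x k g)
    (hG : ¬ G.IsSplit) : ∃ h, TorsionGen F.germData x (n + k) h := by
  obtain ⟨q, Q⟩ := hQ
  obtain ⟨g, hg, gen, ann⟩ := torsionGen_sub_iff.1 hg
  obtain ⟨h, hgen, hgh, hdvd⟩ := exists_generators_of_not_isSplit hx hn Q hg gen hG
  refine ⟨h, hgen, fun y a => ?_⟩
  have hmul : ∀ b : stalk y, (mult x n y * b) • h y = b • g y := fun b => by
    rw [hgh y, ← mul_smul, mul_comm]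
  rw [mult_add]
  constructor
  · intro ha
    have ha' : a • h y = 0 := ha
    -- Zero lies in `G`, so an annihilator of `h y` is divisible by `mult x n y`; the cofactor then
    -- annihilates `g y = mult x n y • h y`.
    obtain ⟨b, rfl⟩ := hdvd y a (ha'.symm ▸ G.zero_mem_germs y)
    exact mul_dvd_mul_left _ ((ann y b).1 ((hmul b).symm.trans ha'))
  · rintro ⟨b, rfl⟩
    have h₁ := hmul (mult x k y * b)
    rw [← mul_assoc] at h₁
    exact h₁.trans ((ann y _).2 (dvd_mul_right _ _))

/-- The subsheaf `uⁿ 𝒯_{x,n+k}` is isomorphic to `𝒯_{x,k}` and has quotient `𝒯_{x,n}`. -/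
theorem torsionGen_powSub_of_torsionGen (hx : x ≠ P1.eta) {n k : ℕ} {h : ∀ y, F.sheaf.Germ y}
    (H : TorsionGen F.germData x (n + k) h) :
    (∃ q, TorsionGen (powSub F x n).quotData x n q) ∧
      ∃ g, TorsionGen (powSub F x n).toNormalCoh.germData x k g := by
  have hann : ∀ y (a : stalk y), a • h y = 0 ↔ mult x n y * mult x k y ∣ a := fun y a => by
    rw [← mult_add]
    exact H.ann y a
  refine ⟨⟨_, torsionGen_powSub H.gen fun y a b hab => ?_⟩, torsionGen_sub_iff.2
    ⟨fun y => mult x n y • h y, fun y => mem_powSub.2 ⟨_, rfl⟩, fun y m hm => ?_, fun y a => ?_⟩⟩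
  · rcases H.eq_or hx hab with rfl | ⟨h₁, -⟩
    · exact dvd_mul_right _ _
    · exact (dvd_mul_right _ _).trans ((hann y a).1 h₁)
  · obtain ⟨m', rfl⟩ := mem_powSub.1 hm
    obtain ⟨a, rfl⟩ := H.gen y m'
    refine ⟨a, ?_⟩
    change mult x n y • a • h y = a • mult x n y • h y
    rw [← mul_smul, ← mul_smul, mul_comm]
  · rw [← mul_smul, hann, mul_comm a]
    constructor
    · rintro ⟨b, hb⟩
      rw [mul_assoc] at hb
      exact ⟨b, stalk_mul_cancel (mult_ne_zero x n y) hb⟩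
    · exact mul_dvd_mul_left _

/-- A nonsplit extension of `𝒯_{x,n}` by `𝒪(m)` is `𝒪(m + n)`. -/
theorem lineGen_of_not_isSplit (hx : x ≠ P1.eta) {n : ℕ} (hn : 0 < n) {i : P1 → ℤ} {G : CohSub F}
    (hQ : ∃ q, TorsionGen G.quotData x n q) (hg : ∃ g, LineGen G.toNormalCoh.germData g i)
    (hG : ¬ G.IsSplit) : ∃ h, LineGen F.germData h (fun y => i y - multDeg x n y) := by
  obtain ⟨q, Q⟩ := hQ
  obtain ⟨g, hg, gen, inj, hρ⟩ := lineGen_sub_iff.1 hg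
  obtain ⟨h, hgen, hgh, hdvd⟩ := exists_generators_of_not_isSplit hx hn Q hg gen hG
  -- The closed point `x` does not affect the generic stalk, so the generic generator of `G` also
  -- serves for `F`; only the exponents change.
  have hη : g P1.eta = h P1.eta := by rw [hgh, mult_eta, one_smul]
  rw [hη] at inj hρ
  refine ⟨h, hgen, inj, fun y => ?_⟩
  have h₁ := hρ y
  rw [hgh y, F.sheaf.gen_smul, inclusion_mult] at h₁
  have h₂ := eq_etaPow_neg_smul h₁
  rw [etaPow_smul_smul, neg_add_eq_sub] at h₂
  exact h₂

/-- The subsheaf `uⁿ 𝒪(m + n)` is isomorphic to `𝒪(m)` and has quotient `𝒯_{x,n}`. -/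
theorem lineGen_powSub_of_lineGen (x : P1) (n : ℕ) {i : P1 → ℤ} {h : ∀ y, F.sheaf.Germ y}
    (H : LineGen F.germData h i) :
    (∃ q, TorsionGen (powSub F x n).quotData x n q) ∧
      ∃ g, LineGen (powSub F x n).toNormalCoh.germData g (fun y => i y + multDeg x n y) := by
  have hη : mult x n P1.eta • h P1.eta = h P1.eta := by rw [mult_eta, one_smul]
  refine ⟨⟨_, torsionGen_powSub H.gen fun y a b hab => ?_⟩, lineGen_sub_iff.2
    ⟨fun y => mult x n y • h y, fun y => mem_powSub.2 ⟨_, rfl⟩, fun y m hm => ?_, ?_,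
      fun y => ?_⟩⟩
  · rw [H.inj_at hab]
    exact dvd_mul_right _ _
  · obtain ⟨m', rfl⟩ := mem_powSub.1 hm
    obtain ⟨a, rfl⟩ := H.gen y m'
    refine ⟨a, ?_⟩
    change mult x n y • a • h y = a • mult x n y • h y
    rw [← mul_smul, ← mul_smul, mul_comm]
  · beta_reduce
    rw [hη]
    exact H.inj
  · have h₁ : F.sheaf.gen y (h y) = etaPow (i y) • h P1.eta := H.map_ρ y
    rw [F.sheaf.gen_smul, h₁, inclusion_mult, etaPow_smul_smul, add_comm]
    exact congrArg (etaPow (i y + multDeg x n y) • ·) hη.symm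

end CohSub

/-! ### Isomorphism classes -/

theorem isoClass_eq_torsionSheaf_iff {F : NormalCoh} {x : P1} (hx : x ≠ P1.eta) {n : ℕ+} :
    isoClass F = isoClass (torsionSheaf x n) ↔ ∃ h, TorsionGen F.germData x n h := by
  rw [← nonempty_iso_torsionData hx, eq_comm]
  exact isoClass_glued_eq_iff.trans ⟨fun ⟨i⟩ => ⟨i.symm⟩, fun ⟨i⟩ => ⟨i.symm⟩⟩

theorem isoClass_quotient_eq_torsionSheaf_iff {F : NormalCoh} {G : CohSub F} {x : P1}
    (hx : x ≠ P1.eta) {n : ℕ+} :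
    isoClass G.quotient = isoClass (torsionSheaf x n) ↔ ∃ q, TorsionGen G.quotData x n q := by
  rw [← nonempty_iso_torsionData hx]
  exact isoClass_glued_eq_glued_iff

theorem isoClass_eq_lineBundle_iff {F : NormalCoh} {m : ℤ} :
    isoClass F = isoClass (lineBundle m) ↔
      ∃ h i, LineGen F.germData h i ∧ i P1.infty - i P1.origin = m := by
  rw [← nonempty_iso_lineData, eq_comm]
  exact isoClass_glued_eq_iff.trans ⟨fun ⟨i⟩ => ⟨i.symm⟩, fun ⟨i⟩ => ⟨i.symm⟩⟩

theorem isSplit_of_quotient_lineBundle {F : NormalCoh} {G : CohSub F} {m : ℤ}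
    (h : isoClass G.quotient = isoClass (lineBundle m)) : G.IsSplit := by
  obtain ⟨i⟩ := isoClass_glued_eq_glued_iff.1 h
  exact CohSub.isSplit_of_torsionFree i fun y a q => (lineGen_lineData m).torsionFree

/-- Nonzero elements act injectively on a cyclic sheaf, so it is torsion-free. -/
theorem isSplit_of_quotient_cyclicSheaf {F : NormalCoh} {G : CohSub F} {n : ℕ+}
    (h : isoClass G.quotient = isoClass (cyclicSheaf n)) : G.IsSplit := by
  obtain ⟨i⟩ := isoClass_glued_eq_glued_iff.1 h
  refine CohSub.isSplit_of_torsionFree i fun y a (q : CycMod n) hq => ?_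
  by_cases ha : a = 0
  · exact Or.inl ha
  · exact Or.inr (CycMod.smul_inj ha (hq.trans (smul_zero a).symm))

/-- Every power of `t`, positive or negative, acts on a cyclic sheaf, so it is divisible. -/
theorem isSplit_of_sub_cyclicSheaf {F : NormalCoh} {G : CohSub F} {n : ℕ+}
    (h : isoClass G.toNormalCoh = isoClass (cyclicSheaf n)) : G.IsSplit := by
  obtain ⟨i⟩ := isoClass_glued_eq_iff.1 h.symm
  refine CohSub.isSplit_of_divisible i fun y a ha (q : CycMod n) =>
    ⟨((a : Laurent)⁻¹ • q : CycMod n), ?_⟩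
  change q = (a : Laurent) • (a : Laurent)⁻¹ • q
  rw [← mul_smul, mul_inv_cancel₀ (stalk_val_ne ha), one_smul]

/-! ### The commutators -/

theorem commutator_lineBundle_lineBundle (n m : ℤ) :
    IsHallCommutator (delta (lineBundle n)) (delta (lineBundle m)) 0 :=
  isHallCommutator_zero_of_isSplit (fun _ _ hG => isSplit_of_quotient_lineBundle hG.1)
    fun _ _ hG => isSplit_of_quotient_lineBundle hG.1

theorem commutator_cyclicSheaf (n : ℕ+) (F : NormalCoh) :
    IsHallCommutator (delta (cyclicSheaf n)) (delta F) 0 :=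
  isHallCommutator_zero_of_isSplit (fun _ _ hG => isSplit_of_quotient_cyclicSheaf hG.1)
    fun _ _ hG => isSplit_of_sub_cyclicSheaf hG.2

/-- The supports are disjoint: at `x` the subsheaf has zero stalk, and at every other point the
quotient does, so that nothing lies outside the subsheaf. Either way the splitting condition holds.
-/
theorem commutator_torsionSheaf_of_ne {x x' : P1} (hx : x ≠ P1.eta) (hx' : x' ≠ P1.eta)
    (hne : x ≠ x') (n m : ℕ+) :
    IsHallCommutator (delta (torsionSheaf x n)) (delta (torsionSheaf x' m)) 0 := by
  have key : ∀ {x x' : P1}, x ≠ P1.eta → x' ≠ P1.eta → x ≠ x' → ∀ (n m : ℕ+) (F : NormalCoh),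
      ∀ G ∈ hallSet (torsionSheaf x n) (torsionSheaf x' m) F, G.IsSplit := by
    rintro x x' hx hx' hne n m F G ⟨hA, hB⟩ y a r hr har
    obtain ⟨q, Q⟩ := (isoClass_quotient_eq_torsionSheaf_iff hx).1 hA
    obtain ⟨g, H⟩ := (isoClass_eq_torsionSheaf_iff hx').1 hB
    by_cases hy : y = x
    · subst hy
      exact congrArg Subtype.val (H.eq_zero hne ⟨a • r, har⟩)
    · exact absurd (CohSub.mk_eq_zero.1 (Q.eq_zero hy (QuotMod.mk (G.germs y) r))) hr
  exact isHallCommutator_zero_of_isSplit (key hx hx' hne n m) (key hx' hx hne.symm m n)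

/-- The stalks of `𝒯_{x,n+k}` are cyclic, so the quotient `𝒯_{x,n}` forces the subsheaf to be `uⁿ
F`. -/
theorem hallSet_torsionSheaf_torsionSheaf {x : P1} (hx : x ≠ P1.eta) (n k : ℕ+) {F : NormalCoh}
    (hF : isoClass F = isoClass (torsionSheaf x (n + k))) :
    hallSet (torsionSheaf x n) (torsionSheaf x k) F = {CohSub.powSub F x n} := by
  obtain ⟨h, H⟩ := (isoClass_eq_torsionSheaf_iff hx).1 hF
  refine Set.eq_singleton_iff_unique_mem.2 ⟨?_, fun G hG => ?_⟩
  · rw [PNat.add_coe] at H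
    obtain ⟨h₁, h₂⟩ := CohSub.torsionGen_powSub_of_torsionGen hx H
    exact ⟨(isoClass_quotient_eq_torsionSheaf_iff hx).2 h₁,
      (isoClass_eq_torsionSheaf_iff hx).2 h₂⟩
  · obtain ⟨q, Q⟩ := (isoClass_quotient_eq_torsionSheaf_iff hx).1 hG.1
    exact CohSub.eq_powSub Q H.gen

theorem isSplit_of_torsionSheaf_torsionSheaf {x : P1} (hx : x ≠ P1.eta) {n k : ℕ+} {F : NormalCoh}
    (hF : isoClass F ≠ isoClass (torsionSheaf x (n + k))) {G : CohSub F}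
    (hG : G ∈ hallSet (torsionSheaf x n) (torsionSheaf x k) F) : G.IsSplit := by
  by_contra h
  exact hF ((isoClass_eq_torsionSheaf_iff hx).2 (CohSub.torsionGen_of_not_isSplit hx n.pos
    ((isoClass_quotient_eq_torsionSheaf_iff hx).1 hG.1)
    ((isoClass_eq_torsionSheaf_iff hx).1 hG.2) h))

/-- The only nonsplit extension, `𝒯_{x,n+k}`, is symmetric in `n` and `k` and has exactly one
relevant subsheaf in either order, so its contributions cancel. -/
theorem commutator_torsionSheaf_self {x : P1} (hx : x ≠ P1.eta) (n k : ℕ+) :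
    IsHallCommutator (delta (torsionSheaf x n)) (delta (torsionSheaf x k)) 0 := by
  refine isHallCommutator_of_isSplit (E := torsionSheaf x (n + k))
    (fun F hF G hG => isSplit_of_torsionSheaf_torsionSheaf hx hF hG)
    (fun F hF G hG => isSplit_of_torsionSheaf_torsionSheaf hx (add_comm n k ▸ hF) hG)
    (fun _ _ => rfl) fun F hF => ?_
  rw [hallSet_torsionSheaf_torsionSheaf hx n k hF,
    hallSet_torsionSheaf_torsionSheaf hx k n (add_comm n k ▸ hF), Set.ncard_singleton,
    Set.ncard_singleton, sub_self]
  exact ⟨Set.finite_singleton _, Set.finite_singleton _, rfl⟩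

theorem hallSet_torsionSheaf_lineBundle {x : P1} (hx : x ≠ P1.eta) (n : ℕ+) (m : ℤ)
    {F : NormalCoh} (hF : isoClass F = isoClass (lineBundle (m + (n : ℤ)))) :
    hallSet (torsionSheaf x n) (lineBundle m) F = {CohSub.powSub F x n} := by
  obtain ⟨h, i, H, hi⟩ := isoClass_eq_lineBundle_iff.1 hF
  refine Set.eq_singleton_iff_unique_mem.2 ⟨?_, fun G hG => ?_⟩
  · obtain ⟨h₁, g, h₂⟩ := CohSub.lineGen_powSub_of_lineGen x n H
    refine ⟨(isoClass_quotient_eq_torsionSheaf_iff hx).2 h₁,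
      isoClass_eq_lineBundle_iff.2 ⟨g, _, h₂, ?_⟩⟩
    have h₃ := multDeg_sub hx n
    omega
  · obtain ⟨q, Q⟩ := (isoClass_quotient_eq_torsionSheaf_iff hx).1 hG.1
    exact CohSub.eq_powSub Q H.gen

theorem isSplit_of_torsionSheaf_lineBundle {x : P1} (hx : x ≠ P1.eta) {n : ℕ+} {m : ℤ}
    {F : NormalCoh} (hF : isoClass F ≠ isoClass (lineBundle (m + (n : ℤ)))) {G : CohSub F}
    (hG : G ∈ hallSet (torsionSheaf x n) (lineBundle m) F) : G.IsSplit := by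
  by_contra h
  obtain ⟨g, i, H, hi⟩ := isoClass_eq_lineBundle_iff.1 hG.2
  obtain ⟨r, R⟩ := CohSub.lineGen_of_not_isSplit hx n.pos
    ((isoClass_quotient_eq_torsionSheaf_iff hx).1 hG.1) ⟨g, H⟩ h
  refine hF (isoClass_eq_lineBundle_iff.2 ⟨r, _, R, ?_⟩)
  have h₃ := multDeg_sub hx n
  omega

/-- A line bundle has no torsion subsheaves. -/
theorem hallSet_lineBundle_torsionSheaf {x : P1} (hx : x ≠ P1.eta) (n : ℕ+) (m k : ℤ)
    {F : NormalCoh} (hF : isoClass F = isoClass (lineBundle k)) :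
    hallSet (lineBundle m) (torsionSheaf x n) F = ∅ := by
  obtain ⟨h, i, H, -⟩ := isoClass_eq_lineBundle_iff.1 hF
  refine Set.eq_empty_of_forall_notMem fun G hG => ?_
  obtain ⟨g, T⟩ := (isoClass_eq_torsionSheaf_iff hx).1 hG.2
  have h₁ : mult x n x • g x = 0 := (T.ann x _).2 dvd_rfl
  let r : F.sheaf.Germ x := (g x).1
  have hr : mult x n x • r = 0 := congrArg Subtype.val h₁
  rcases H.torsionFree hr with h₂ | h₂
  -- The generator of a torsion subsheaf is nonzero yet killed by the nonzero element `uⁿ`; neither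
  -- alternative of torsion-freeness is possible.
  · exact mult_ne_zero x n x h₂
  · exact T.ne_zero hx n.pos (Subtype.ext h₂)

/-- Only `𝒪(m+n)` can be a nonsplit extension of `𝒯_{x,n}` by `𝒪(m)`. It contains one subsheaf for
this order and none for the reverse order, whose extensions all split because the quotient is
torsion-free. -/
theorem commutator_torsionSheaf_lineBundle {x : P1} (hx : x ≠ P1.eta) (n : ℕ+) (m : ℤ) :
    IsHallCommutator (delta (torsionSheaf x n)) (delta (lineBundle m))
      (delta (lineBundle (m + (n : ℤ)))) := by
  refine isHallCommutator_of_isSplit (E := lineBundle (m + (n : ℤ)))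
    (fun F hF G hG => isSplit_of_torsionSheaf_lineBundle hx hF hG)
    (fun F _ G hG => isSplit_of_quotient_lineBundle hG.1) (fun F hF => ?_) fun F hF => ?_
  · exact Finsupp.single_eq_of_ne hF
  · rw [hallSet_torsionSheaf_lineBundle hx n m hF, hallSet_lineBundle_torsionSheaf hx n m _ hF,
      Set.ncard_singleton, Set.ncard_empty, hF, delta, Finsupp.single_eq_same]
    exact ⟨Set.finite_singleton _, Set.finite_empty, by simp⟩

end PLine

theorem mainTheorem6 :
    (∀ n m : ℤ, PLine.IsHallCommutator (PLine.delta (PLine.lineBundle n))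
      (PLine.delta (PLine.lineBundle m)) 0) ∧
    (∀ x : PLine.P1, x ≠ PLine.P1.eta → ∀ (n : ℕ+) (m : ℤ),
      PLine.IsHallCommutator (PLine.delta (PLine.torsionSheaf x n))
        (PLine.delta (PLine.lineBundle m)) (PLine.delta (PLine.lineBundle (m + (n : ℤ))))) ∧
    (∀ x x' : PLine.P1, x ≠ PLine.P1.eta → x' ≠ PLine.P1.eta → ∀ n m : ℕ+,
      PLine.IsHallCommutator (PLine.delta (PLine.torsionSheaf x n))
        (PLine.delta (PLine.torsionSheaf x' m)) 0) ∧
    (∀ (n : ℕ+) (F : PLine.NormalCoh), F.Indecomposable →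
      PLine.IsHallCommutator (PLine.delta (PLine.cyclicSheaf n)) (PLine.delta F) 0) := by
  refine ⟨PLine.commutator_lineBundle_lineBundle,
    fun x hx n m => PLine.commutator_torsionSheaf_lineBundle hx n m,
    fun x x' hx hx' n m => ?_, fun n F _ => PLine.commutator_cyclicSheaf n F⟩
  by_cases h : x = x'
  · subst h
    exact PLine.commutator_torsionSheaf_self hx n m
  · exact PLine.commutator_torsionSheaf_of_ne hx hx' h n m
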